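/- **Norms.** For $s\in[0,1)$ let $\|f\|_{C^s(\mathbb R^d)}$ be the usual Hölder norm (the sup norm of a continuous function if $s=0$; the sup norm plus the $s$-Hölder seminorm if $s>0$). For $s<0$ set recursively $$\|f\|_{C^s(\mathbb R^d)}:=\inf_{\nabla\cdot g=f}\|g\|_{C^{s+1}(\mathbb R^d)},$$ where the divergence is taken in the sense of distributions, $g$ has one more index than $f$, and the infimum over the empty set is $+\infty$. **Solutions.** For $u:[0,1]\times\mathbb R^2\to\mathbb R^2$ smooth on $(0,1]\times\mathbb R^2$, $W\in C^0((0,1],\mathbb R^2)$, $s\in(0,1]$ and $y\in\mathbb R^2$, denote by $t\mapsto X^{s,y,u,W}_t$, $t\in[s,1]$, the solution of $$X_t=y+\int_s^t u(r,X_r)\,dr+W_t-W_s .$$ **Explosive separation.** A random velocity field $u$ with law $\mathbb P$ is *explosively separating* for a sequence of times $T^n\in(0,1]$ with $T^n\to0$ and a path $W$ if $$\lim_{n\to\infty}\ \limsup_{\delta\to0^+}\ \limsup_{|x-y|\to0,\ x\ne y}\ \limsup_{m\to\infty}\ \mathbb P\big(|X^{T^m,x,u,W}_{T^n}-X^{T^m,y,u,W}_{T^n}|<\delta\big)=0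 .$$ **Theorem 1.6.** 1. For every real $\alpha<1/2$ there is a random velocity field $v^\alpha:[0,1]\times\mathbb R^2\to\mathbb R^2$ such that, surely, $\|v^\alpha(t,\cdot)\|_{C^\alpha(\mathbb R^2)}\le2$ for all $t\in[0,1]$, $v^\alpha\in C^\infty_{\mathrm{loc}}((0,1]\times\mathbb R^2)$, and the solutions $X^{s,y,v^\alpha,W}$ exist on $[s,1]$ and are unique for all $W\in C^0((0,1],\mathbb R^2)$, $s\in(0,1]$, $y\in\mathbb R^2$; and there is a deterministic sequence of times $T^n\in(0,1]$, $T^n\to0$, such that for every $\beta$ with $\frac1{2(1-\alpha)}<\beta\le1$ and every deterministic $W\in C^\beta([0,1],\mathbb R^2)$ (Lipschitz if $\beta=1$), $v^\alpha$ is explosively separating for $(T^n)$ and $W$. 2. For every $\rho\in(0,1/2)$ there is a random velocity field $u^\rho:[0,1]\times\mathbb R^2\to\mathbb R^2$ such that, surely, $\|u^\rho(t,\cdot)\|_{C^{-\rho}(\mathbb R^2)}\le2$ for all $t\in[0,1]$, $u^\rho\in L^1([0,1],C^0(\mathbb R^2))\cap C^\infty_{\mathrm{loc}}((0,1]\times\mathbb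 R^2)$, and the solutions $X^{s,y,u^\rho,W}$ exist on $[s,1]$ and are unique for all $W\in C^0((0,1],\mathbb R^2)$, $s\in(0,1]$, $y\in\mathbb R^2$; and there is a deterministic sequence of times $T^n\in(0,1]$, $T^n\to0$, such that for every deterministic $W\in C^{\frac{1+\rho/8}{2+\rho/2}}([0,1],\mathbb R^2)$, $u^\rho$ is explosively separating for $(T^n)$ and $W$. -/

import Mathlib

open Set Filter Topology MeasureTheory
open scoped NNReal ENNReal Distributions

noncomputable section

namespace ExplosiveSeparation

/-- Euclidean space `ℝ^d` with the Euclidean norm. -/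
abbrev Space (d : ℕ) : Type := EuclideanSpace ℝ (Fin d)

/-! ### Hölder norms of order less than one, negative orders included -/

section Norms

variable {d : ℕ} {F : Type} [NormedAddCommGroup F] [NormedSpace ℝ F]

/-- The usual Hölder norm of order `r ∈ [0, 1)` of a function on `ℝ^d`, with values in `[0, ∞]`:
the sup norm if `r = 0`, the sup norm plus the Hölder seminorm if `r > 0`, and `∞` for
discontinuous functions. -/
def holderNorm (r : ℝ) (f : Space d → F) : ℝ≥0∞ :=
  open Classical in
  if Continuous f then
    (⨆ x, ‖f x‖ₑ) + (if r = 0 then 0 else eHolderNorm r.toNNReal f)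
  else ∞

/-- The distribution `T` on `ℝ^d` is given by integration against the locally integrable
function `f`. -/
def Represents (T : 𝓓'((⊤ : TopologicalSpace.Opens (Space d)), F)) (f : Space d → F) : Prop :=
  LocallyIntegrable f volume ∧
    ∀ φ : 𝓓((⊤ : TopologicalSpace.Opens (Space d)), ℝ), T φ = ∫ x, φ x • f x

/-- The distributional divergence `∑ i, ∂ᵢ gᵢ` of a distribution `g = (g₁, …, g_d)` whose
components are `F`-valued. The space `F^d` carries the `ℓ²` norm, so that iterating the
construction produces tensors with the Euclidean (Frobenius) norm. -/
def divergence
    (g : 𝓓'((⊤ : TopologicalSpace.Opens (Space d)), PiLp 2 (fun _ : Fin d => F))) :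
    𝓓'((⊤ : TopologicalSpace.Opens (Space d)), F) :=
  ∑ i : Fin d, Distribution.lineDerivCLM (EuclideanSpace.single i (1 : ℝ))
    (Distribution.mapCLM (PiLp.proj 2 (𝕜 := ℝ) (fun _ : Fin d => F) i) g)

end Norms

/-- The recursion behind the norms of negative order: `k` is the number of times a divergence has
to be inverted before the order `s + k` is nonnegative. -/
def distNormAux {d : ℕ} : (k : ℕ) → (s : ℝ) →
    {F : Type} → [NormedAddCommGroup F] → [NormedSpace ℝ F] →
    𝓓'((⊤ : TopologicalSpace.Opens (Space d)), F) → ℝ≥0∞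
  | 0, s, F, _, _, T => ⨅ (f : Space d → F) (_ : Represents T f), holderNorm s f
  | k + 1, s, F, _, _, T =>
      ⨅ (g : 𝓓'((⊤ : TopologicalSpace.Opens (Space d)), PiLp 2 (fun _ : Fin d => F)))
        (_ : divergence g = T), distNormAux k (s + 1) g

/-- The `C^s` norm, `s < 1`, of a distribution on `ℝ^d`: the Hölder norm if `0 ≤ s`, and
`‖T‖_{C^s} = inf {‖g‖_{C^{s+1}} : ∇ · g = T}` recursively if `s < 0`. -/
def distNorm {d : ℕ} {F : Type} [NormedAddCommGroup F] [NormedSpace ℝ F] (s : ℝ)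
    (T : 𝓓'((⊤ : TopologicalSpace.Opens (Space d)), F)) : ℝ≥0∞ :=
  distNormAux ⌈-s⌉₊ s T

/-- The `C^s` norm, `s < 1`, of a function on `ℝ^d`. For `s < 0` the function is regarded as a
distribution (the norm is `∞` if it is not locally integrable). -/
def cNorm {d : ℕ} {F : Type} [NormedAddCommGroup F] [NormedSpace ℝ F] (s : ℝ)
    (f : Space d → F) : ℝ≥0∞ :=
  open Classical in
  if 0 ≤ s then holderNorm s f
  else ⨅ (T : 𝓓'((⊤ : TopologicalSpace.Opens (Space d)), F)) (_ : Represents T f), distNorm s T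

/-! ### Velocity fields and driving paths on the time interval `[0, 1]` -/

section Fields

variable {d : ℕ}

/-- `u ∈ C^∞_loc((0, 1] × ℝ^d)`. -/
def SmoothPositiveTimes (u : ℝ → Space d → Space d) : Prop :=
  ContDiffOn ℝ ((⊤ : ℕ∞) : WithTop ℕ∞) (fun p : ℝ × Space d => u p.1 p.2) (Ioc 0 1 ×ˢ univ)

/-- `u ∈ L¹([0, 1], C⁰(ℝ^d))` in the sense of Bochner, `C⁰(ℝ^d)` being the Banach space of
bounded continuous functions with the sup norm. -/
def MemL1C0 (u : ℝ → Space d → Space d) : Prop :=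
  ∃ U : ℝ → BoundedContinuousFunction (Space d) (Space d),
    IntegrableOn U (Icc 0 1) volume ∧
      ∀ᵐ t ∂(volume.restrict (Icc (0 : ℝ) 1)), ∀ x, U t x = u t x

/-- `W ∈ C^β([0, 1], ℝ^d)` for `0 < β ≤ 1`. -/
def HolderPath (β : ℝ) (W : ℝ → Space d) : Prop :=
  ∃ C : ℝ≥0, HolderOnWith C β.toNNReal W (Icc 0 1)

/-- `X` solves `dX_t = u(t, X_t) dt + dW_t`, `X_s = y`, on `[s, 1]`. -/
def IsSolution (u : ℝ → Space d → Space d) (W : ℝ → Space d) (s : ℝ) (y : Space d)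
    (X : ℝ → Space d) : Prop :=
  ContinuousOn X (Icc s 1) ∧
    ∀ t ∈ Icc s 1, X t = y + (∫ r in s..t, u r (X r)) + (W t - W s)

/-- For every continuous driving path, every initial time `s ∈ (0, 1]` and every initial
position, there is exactly one solution on `[s, 1]`. -/
def UniquelySolvable (u : ℝ → Space d → Space d) : Prop :=
  ∀ W : ℝ → Space d, ContinuousOn W (Ioc 0 1) → ∀ s ∈ Ioc (0 : ℝ) 1, ∀ y : Space d,
    ∃ X : ℝ → Space d, IsSolution u W s y X ∧ ∀ Y, IsSolution u W s y Y → EqOn Y X (Icc s 1)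

/-- The solution `t ↦ X^{s,y,u,W}_t`, `t ∈ [s, 1]` (only meaningful if a unique solution
exists). -/
def solution (u : ℝ → Space d → Space d) (W : ℝ → Space d) (s : ℝ) (y : Space d) :
    ℝ → Space d :=
  open Classical in
  if h : ∃ X, IsSolution u W s y X then h.choose else fun _ => y

/-- The filter `|x - y| → 0` on pairs of distinct points. -/
def closePairs (d : ℕ) : Filter (Space d × Space d) :=
  comap (fun p => ‖p.1 - p.2‖) (𝓝[>] 0)

/-- A random velocity field, defined on the probability space `(Ω, P)`, is explosively separating
for the times `T` and the path `W`. -/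
def ExplosivelySeparating {Ω : Type} [MeasurableSpace Ω] (P : Measure Ω)
    (u : Ω → ℝ → Space d → Space d) (T : ℕ → ℝ) (W : ℝ → Space d) : Prop :=
  Tendsto (fun n : ℕ =>
    limsup (fun δ : ℝ =>
      limsup (fun p : Space d × Space d =>
        limsup (fun m : ℕ =>
          P {ω | ‖solution (u ω) W (T m) p.1 (T n) - solution (u ω) W (T m) p.2 (T n)‖ < δ})
          atTop)
        (closePairs d))
      (𝓝[>] 0))
    atTop (𝓝 0)

end Fields

end ExplosiveSeparation

end

/-!
The field shears the plane during consecutive time intervals accumulating at `0`. The `n`-th shear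
is a random plane wave of wavelength `len n` and strength `κ n` (the displacement relative to
the wavelength), with four possible directions and four possible phases.

The inverse distance `1 / ‖D‖` of two trajectories is a Lyapunov function. Averaged over the
direction and the phase, one shear of strength `κ` multiplies `1 / ‖D‖` by a factor
`1 - c κ²` once `‖D‖` is below the wavelength, and in general this holds up to an error of order
`κ² / len`. Because the starting distance may be arbitrarily small, the contraction has to be
infinitely strong: `κ n` is of order `n ^ (-1 / 2)`, so that `∑ κ n ^ 2 = ∞`. The inverse
distance at the `n`-th time is then of order `1 / len n` in expectation, no matter how early and
how close the trajectories start. The path `W` is harmless as long as its oscillation during the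
`n`-th interval stays below `len n`, and this is the condition on its Hölder exponent.
-/

noncomputable section

namespace ExplosiveSeparation

/-! ### Norms of plane waves -/

section PlaneWave

variable {d : ℕ} {F : Type} [NormedAddCommGroup F] [NormedSpace ℝ F]

/-- The plane wave with frequency vector `ν`, phase `φ` and amplitude vector `w`. -/
def planeWave (ν : Space d) (φ : ℝ) (w : F) (x : Space d) : F :=
  Real.sin (inner ℝ x ν + φ) • w

lemma contDiff_planeWave (ν : Space d) (φ : ℝ) (w : F) {n : WithTop ℕ∞} :
    ContDiff ℝ n (planeWave ν φ w) := by
  have hphase : ContDiff ℝ n fun x : Space d => inner ℝ x ν + φ :=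
    (contDiff_id.inner ℝ contDiff_const).add contDiff_const
  exact hphase.sin.smul contDiff_const

lemma continuous_planeWave (ν : Space d) (φ : ℝ) (w : F) : Continuous (planeWave ν φ w) :=
  (contDiff_planeWave ν φ w (n := 0)).continuous

lemma norm_planeWave_le (ν : Space d) (φ : ℝ) (w : F) (x : Space d) :
    ‖planeWave ν φ w x‖ ≤ ‖w‖ := by
  rw [planeWave, norm_smul, Real.norm_eq_abs]
  exact mul_le_of_le_one_left (norm_nonneg _) (Real.abs_sin_le_one _)

lemma lipschitzWith_inner_add (ν : Space d) (φ : ℝ) :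
    LipschitzWith ‖ν‖₊ fun x => inner ℝ x ν + φ := by
  refine LipschitzWith.of_dist_le_mul fun x y => ?_
  rw [dist_add_right, dist_eq_norm, ← inner_sub_left, dist_eq_norm, mul_comm]
  exact norm_inner_le_norm _ _

lemma lipschitzWith_smul_const (w : F) : LipschitzWith ‖w‖₊ fun c : ℝ => c • w := by
  simpa only [ContinuousLinearMap.nnnorm_toSpanSingleton] using!
    (ContinuousLinearMap.toSpanSingleton ℝ w).lipschitz

lemma lipschitzWith_planeWave (ν : Space d) (φ : ℝ) (w : F) :
    LipschitzWith (‖ν‖₊ * ‖w‖₊) (planeWave ν φ w) := by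
  have hwave := (lipschitzWith_smul_const w).comp
    (Real.lipschitzWith_sin.comp (lipschitzWith_inner_add ν φ))
  simpa only [one_mul, mul_comm] using! hwave

lemma holderWith_two_sin {r : ℝ≥0} (hr : r ≤ 1) : HolderWith 2 r Real.sin := by
  have hbound : HolderWith 2 0 Real.sin := fun x y => by
    rw [NNReal.coe_zero, ENNReal.rpow_zero, mul_one, edist_nndist, ENNReal.coe_le_coe,
      ← NNReal.coe_le_coe, coe_nndist, Real.dist_eq]
    exact (abs_sub _ _).trans (add_le_add (Real.abs_sin_le_one x) (Real.abs_sin_le_one y)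
      |>.trans_eq (by norm_num))
  simpa using hbound.of_le_of_le (holderWith_one.2 Real.lipschitzWith_sin) zero_le hr

lemma holderWith_planeWave (ν : Space d) (φ : ℝ) (w : F) {r : ℝ≥0} (hr : r ≤ 1) :
    HolderWith (2 * ‖ν‖₊ ^ (r : ℝ) * ‖w‖₊) r (planeWave ν φ w) := by
  have hwave := (holderWith_one.2 (lipschitzWith_smul_const w)).comp
    ((holderWith_two_sin hr).comp (holderWith_one.2 (lipschitzWith_inner_add ν φ)))
  simpa only [NNReal.coe_one, NNReal.rpow_one, one_mul, mul_one, mul_comm ‖w‖₊] using! hwave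

lemma holderNorm_planeWave_le {ν : Space d} (hν : 1 ≤ ‖ν‖) (φ : ℝ) (w : F) {r : ℝ}
    (h0 : 0 ≤ r) (h1 : r ≤ 1) :
    holderNorm r (planeWave ν φ w) ≤ ENNReal.ofReal (3 * ‖ν‖ ^ r * ‖w‖) := by
  lift r to ℝ≥0 using h0
  have hsup : ⨆ x, ‖planeWave ν φ w x‖ₑ ≤ ENNReal.ofReal (‖ν‖ ^ (r : ℝ) * ‖w‖) :=
    iSup_le fun x => by
      rw [← ofReal_norm]
      exact ENNReal.ofReal_le_ofReal ((norm_planeWave_le ν φ w x).trans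
        (le_mul_of_one_le_left (norm_nonneg _) (Real.one_le_rpow hν r.2)))
  have hseminorm : eHolderNorm r (planeWave ν φ w) ≤
      ENNReal.ofReal (2 * ‖ν‖ ^ (r : ℝ) * ‖w‖) := by
    refine (holderWith_planeWave ν φ w (by exact_mod_cast h1)).eHolderNorm_le.trans_eq ?_
    rw [← ENNReal.ofReal_coe_nnreal]
    simp only [NNReal.coe_mul, NNReal.coe_ofNat, NNReal.coe_rpow, coe_nnnorm]
  have hsplit : 3 * ‖ν‖ ^ (r : ℝ) * ‖w‖ = ‖ν‖ ^ (r : ℝ) * ‖w‖ + 2 * ‖ν‖ ^ (r : ℝ) * ‖w‖ := by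
    ring
  rw [holderNorm, if_pos (continuous_planeWave ν φ w), hsplit,
    ENNReal.ofReal_add (by positivity) (by positivity), Real.toNNReal_coe]
  refine add_le_add hsup ?_
  split_ifs
  exacts [zero_le, hseminorm]

/-- Integration against a plane wave, as a distribution. -/
def planeWaveDistribution (ν : Space d) (φ : ℝ) (w : F) :
    𝓓'((⊤ : TopologicalSpace.Opens (Space d)), F) :=
  ContinuousLinearMap.toUniformConvergenceCLM _ _ _
    (((1 : ℝ →L[ℝ] ℝ).smulRight w).comp
      (TestFunction.integralAgainstBilinCLM (ContinuousLinearMap.mul ℝ ℝ) volume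
        (fun x : Space d => Real.sin (inner ℝ x ν + φ))))

lemma planeWaveDistribution_apply (ν : Space d) (φ : ℝ) (w : F)
    (f : 𝓓((⊤ : TopologicalSpace.Opens (Space d)), ℝ)) :
    planeWaveDistribution ν φ w f = (∫ x, f x * Real.sin (inner ℝ x ν + φ)) • w := by
  have hloc : LocallyIntegrableOn (fun x : Space d => Real.sin (inner ℝ x ν + φ))
      ((⊤ : TopologicalSpace.Opens (Space d)) : Set (Space d)) volume :=
    (Continuous.locallyIntegrable (by fun_prop)).locallyIntegrableOn _
  change (TestFunction.integralAgainstBilinCLM (ContinuousLinearMap.mul ℝ ℝ) volume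
        (fun x : Space d => Real.sin (inner ℝ x ν + φ)) f) • w = _
  rw [TestFunction.integralAgainstBilinCLM_eq_integral hloc]
  rfl

lemma represents_planeWave [CompleteSpace F] (ν : Space d) (φ : ℝ) (w : F) :
    Represents (planeWaveDistribution ν φ w) (planeWave ν φ w) := by
  refine ⟨(continuous_planeWave ν φ w).locallyIntegrable, fun f => ?_⟩
  rw [planeWaveDistribution_apply, ← integral_smul_const]
  simp_rw [planeWave, mul_smul]

/-- The tensor `ν ⊗ w / ‖ν‖²`: the plane wave with this amplitude and its phase delayed by `π / 2`
has the plane wave with amplitude `w` as its divergence. -/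
def invertTensor (ν : Space d) (w : F) : PiLp 2 (fun _ : Fin d => F) :=
  WithLp.toLp 2 fun i => (ν i / ‖ν‖ ^ 2) • w

lemma norm_invertTensor {ν : Space d} (hν : ν ≠ 0) (w : F) :
    ‖invertTensor ν w‖ = ‖w‖ / ‖ν‖ := by
  have hnorm : ‖ν‖ ≠ 0 := norm_ne_zero_iff.2 hν
  have hentry (i : Fin d) :
      ‖(ν i / ‖ν‖ ^ 2) • w‖ ^ 2 = ‖ν i‖ ^ 2 * (‖w‖ ^ 2 / ‖ν‖ ^ 4) := by
    rw [norm_smul, norm_div, norm_pow, norm_norm]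
    field_simp
  have hsum : ∑ i, ‖(ν i / ‖ν‖ ^ 2) • w‖ ^ 2 = (‖w‖ / ‖ν‖) ^ 2 := by
    simp_rw [hentry]
    rw [← Finset.sum_mul, ← EuclideanSpace.norm_sq_eq]
    field_simp
  rw [PiLp.norm_eq_of_L2, invertTensor]
  simp only [hsum]
  exact Real.sqrt_sq (by positivity)

lemma hasFDerivAt_sin_inner_add (ν : Space d) (φ : ℝ) (x : Space d) :
    HasFDerivAt (fun x : Space d => Real.sin (inner ℝ x ν + φ))
      (Real.cos (inner ℝ x ν + φ) • innerSL ℝ ν) x := by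
  have hphase : HasFDerivAt (fun x : Space d => inner ℝ x ν + φ) (innerSL ℝ ν) x := by
    simpa only [innerSL_apply_apply, real_inner_comm] using
      ((innerSL ℝ ν).hasFDerivAt (x := x)).add_const φ
  exact hphase.sin

lemma integral_fderiv_mul_sin {f : Space d → ℝ} (hf : ContDiff ℝ 1 f) (hsupp : HasCompactSupport f)
    (ν : Space d) (φ : ℝ) (v : Space d) :
    ∫ x, fderiv ℝ f x v * Real.sin (inner ℝ x ν + φ) =
      -(inner ℝ v ν * ∫ x, f x * Real.cos (inner ℝ x ν + φ)) := by
  have hderiv (x : Space d) := (hasFDerivAt_sin_inner_add ν φ x).fderiv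
  have : Continuous fun x => fderiv ℝ f x v :=
    (hf.continuous_fderiv one_ne_zero).clm_apply continuous_const
  have hparts := integral_mul_fderiv_eq_neg_fderiv_mul_of_integrable (μ := volume) (𝕜 := ℝ)
    (f := f) (g := fun x : Space d => Real.sin (inner ℝ x ν + φ)) (v := v)
    (Continuous.integrable_of_hasCompactSupport (by fun_prop)
      (hsupp.fderiv_apply ℝ v).mul_right)
    (by
      simp_rw [hderiv, smul_apply]
      exact Continuous.integrable_of_hasCompactSupport (hf.continuous.mul (by fun_prop))
        hsupp.mul_right)
    (Continuous.integrable_of_hasCompactSupport (hf.continuous.mul (by fun_prop)) hsupp.mul_right)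
    (fun x _ => hf.differentiable one_ne_zero x)
    (fun x _ => (hasFDerivAt_sin_inner_add ν φ x).differentiableAt)
  rw [eq_neg_iff_add_eq_zero, ← eq_neg_iff_add_eq_zero.1 hparts, add_comm, add_left_inj,
    ← integral_const_mul]
  refine integral_congr_ae (Eventually.of_forall fun x => ?_)
  beta_reduce
  rw [hderiv, smul_apply, innerSL_apply_apply, smul_eq_mul, real_inner_comm v ν]
  ring

lemma lineDerivCLM_planeWaveDistribution (ν : Space d) (φ : ℝ) (w : F) (v : Space d) :
    (Distribution.lineDerivCLM v (planeWaveDistribution ν φ w) :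
        𝓓'((⊤ : TopologicalSpace.Opens (Space d)), F)) =
      planeWaveDistribution ν (φ + Real.pi / 2) (inner ℝ v ν • w) := by
  ext f
  have hderiv (x : Space d) : (TestFunction.lineDerivCLM ℝ v f :
      𝓓((⊤ : TopologicalSpace.Opens (Space d)), ℝ)) x = fderiv ℝ f x v := by
    rw [TestFunction.lineDerivCLM_apply_of_le (by simp)]
    exact (f.contDiff.differentiable (by simp) x).lineDeriv_eq_fderiv
  rw [Distribution.lineDerivCLM_apply, planeWaveDistribution_apply, planeWaveDistribution_apply]
  simp_rw [hderiv, ← add_assoc, Real.sin_add_pi_div_two]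
  rw [integral_fderiv_mul_sin (f.contDiff.of_le (by simp)) f.hasCompactSupport, smul_smul,
    ← neg_smul, neg_neg, mul_comm]

lemma mapCLM_planeWaveDistribution {G : Type} [NormedAddCommGroup G] [NormedSpace ℝ G]
    (A : F →L[ℝ] G) (ν : Space d) (φ : ℝ) (w : F) :
    (Distribution.mapCLM A (planeWaveDistribution ν φ w) :
        𝓓'((⊤ : TopologicalSpace.Opens (Space d)), G)) = planeWaveDistribution ν φ (A w) := by
  ext f
  rw [Distribution.mapCLM_apply, planeWaveDistribution_apply, planeWaveDistribution_apply,
    map_smul]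

lemma sum_planeWaveDistribution {ι : Type*} (s : Finset ι) (ν : Space d) (φ : ℝ) (w : ι → F) :
    ∑ i ∈ s, planeWaveDistribution ν φ (w i) = planeWaveDistribution ν φ (∑ i ∈ s, w i) := by
  ext f
  rw [planeWaveDistribution_apply, Finset.smul_sum]
  simp_rw [← planeWaveDistribution_apply]
  exact map_sum (AddMonoidHom.mk'
    (fun T : 𝓓'((⊤ : TopologicalSpace.Opens (Space d)), F) => T f) (fun _ _ => rfl)) _ s

lemma divergence_planeWaveDistribution {ν : Space d} (hν : ν ≠ 0) (φ : ℝ) (w : F) :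
    divergence (planeWaveDistribution ν (φ - Real.pi / 2) (invertTensor ν w)) =
      planeWaveDistribution ν φ w := by
  have hsum : ∑ i, ν i * (ν i / ‖ν‖ ^ 2) = 1 := by
    simp_rw [← mul_div_assoc, ← Finset.sum_div, ← sq, ← EuclideanSpace.real_norm_sq_eq]
    exact div_self (pow_ne_zero 2 (norm_ne_zero_iff.2 hν))
  simp_rw [divergence, mapCLM_planeWaveDistribution, lineDerivCLM_planeWaveDistribution,
    sub_add_cancel]
  rw [sum_planeWaveDistribution]
  simp_rw [PiLp.proj_apply, invertTensor, smul_smul, EuclideanSpace.inner_single_left, map_one,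
    one_mul]
  rw [← Finset.sum_smul, hsum, one_smul]

lemma distNormAux_planeWave_le {ν : Space d} (hν : 1 ≤ ‖ν‖) (k : ℕ) :
    ∀ {F : Type} [NormedAddCommGroup F] [NormedSpace ℝ F] [CompleteSpace F] (s φ : ℝ) (w : F),
      0 ≤ s + k → s + k ≤ 1 →
      distNormAux k s (planeWaveDistribution ν φ w) ≤ ENNReal.ofReal (3 * ‖ν‖ ^ s * ‖w‖) := by
  have hpos : 0 < ‖ν‖ := one_pos.trans_le hν
  induction k with
  | zero =>
    intro F _ _ _ s φ w h0 h1
    rw [Nat.cast_zero, add_zero] at h0 h1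
    exact iInf₂_le_of_le _ (represents_planeWave ν φ w) (holderNorm_planeWave_le hν φ w h0 h1)
  | succ k ih =>
    intro F _ _ _ s φ w h0 h1
    push_cast at h0 h1
    refine iInf₂_le_of_le _ (divergence_planeWaveDistribution (norm_pos_iff.1 hpos) φ w)
      ((ih (s + 1) _ _ (by linarith) (by linarith)).trans_eq ?_)
    rw [norm_invertTensor (norm_pos_iff.1 hpos), Real.rpow_add_one hpos.ne']
    field_simp

lemma cNorm_planeWave_le [CompleteSpace F] {ν : Space d} (hν : 1 ≤ ‖ν‖) {s : ℝ} (hs : s ≤ 1)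
    (φ : ℝ) (w : F) :
    cNorm s (planeWave ν φ w) ≤ ENNReal.ofReal (3 * ‖ν‖ ^ s * ‖w‖) := by
  rw [cNorm]
  split_ifs with h
  · exact holderNorm_planeWave_le hν φ w h hs
  · have hceil := Nat.le_ceil (-s)
    have hceil_lt := Nat.ceil_lt_add_one (show 0 ≤ -s by linarith)
    exact iInf₂_le_of_le _ (represents_planeWave ν φ w)
      (distNormAux_planeWave_le hν _ s φ w (by linarith) (by linarith))

end PlaneWave

/-! ### Unique solvability -/

section Picard

variable {E : Type*} [NormedAddCommGroup E] [NormedSpace ℝ E] [CompleteSpace E]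
  {f : ℝ → E → E} {a b : ℝ} {K B : ℝ≥0}

lemma exists_eq_picard (hab : a ≤ b) (hf : ContinuousOn (Function.uncurry f) (Icc a b ×ˢ univ))
    (hlip : ∀ t ∈ Icc a b, LipschitzWith K (f t)) (hbound : ∀ t ∈ Icc a b, ∀ x, ‖f t x‖ ≤ B)
    (y : E) :
    ∃ X : ℝ → E, ContinuousOn X (Icc a b) ∧ ∀ t ∈ Icc a b, X t = ODE.picard f a y X t := by
  have ha : a ∈ Icc a b := left_mem_Icc.2 hab
  have hPicard : IsPicardLindelof f (⟨a, ha⟩ : Icc a b) y (B * (b - a).toNNReal) 0 B K := by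
    refine ⟨fun t ht => (hlip t ht).lipschitzOnWith, fun x _ => ?_, fun t ht x _ => hbound t ht x,
      ?_⟩
    · exact hf.comp (continuousOn_id.prodMk continuousOn_const) fun t ht => ⟨ht, mem_univ _⟩
    · rw [sub_self, max_eq_left (sub_nonneg.2 hab), NNReal.coe_zero, sub_zero, NNReal.coe_mul,
        Real.coe_toNNReal _ (sub_nonneg.2 hab)]
  obtain ⟨X, hXa, hX⟩ := hPicard.exists_eq_forall_mem_Icc_hasDerivWithinAt₀
  refine ⟨X, fun t ht => (hX t ht).continuousWithinAt, fun t ht => ?_⟩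
  have hsub : uIcc a t ⊆ Icc a b := uIcc_subset_Icc ha ht
  rw [← ODE.picard_eq_of_hasDerivAt (u := univ) (hf.mono (prod_mono_left hsub))
    (fun r hr => (hX r (hsub hr)).mono hsub) (mapsTo_univ _ _)]
  exact congrArg (fun z => ODE.picard f a z X t) hXa

lemma hasDerivWithinAt_of_eq_picard (hf : ContinuousOn (Function.uncurry f) (Icc a b ×ˢ univ))
    {X : ℝ → E} {y : E} (hX : ContinuousOn X (Icc a b))
    (hPicard : ∀ t ∈ Icc a b, X t = ODE.picard f a y X t) {t : ℝ} (ht : t ∈ Ico a b) :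
    HasDerivWithinAt X (f t (X t)) (Ici t) t := by
  have ht' : t ∈ Icc a b := Ico_subset_Icc_self ht
  have hderiv := ODE.hasDerivWithinAt_picard_Icc (u := univ)
    (left_mem_Icc.2 (ht'.1.trans ht'.2)) hf hX (fun _ _ => mem_univ _) y ht'
  exact (hderiv.congr hPicard (hPicard t ht')).mono_of_mem_nhdsWithin
    (mem_of_superset (Icc_mem_nhdsGE ht.2) (Icc_subset_Icc_left ht.1))

lemma eqOn_of_eq_picard (hf : ContinuousOn (Function.uncurry f) (Icc a b ×ˢ univ))
    (hlip : ∀ t ∈ Icc a b, LipschitzWith K (f t)) {X Y : ℝ → E} {y : E}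
    (hXc : ContinuousOn X (Icc a b)) (hX : ∀ t ∈ Icc a b, X t = ODE.picard f a y X t)
    (hYc : ContinuousOn Y (Icc a b)) (hY : ∀ t ∈ Icc a b, Y t = ODE.picard f a y Y t) :
    EqOn X Y (Icc a b) := by
  intro t ht
  have ha : a ∈ Icc a b := left_mem_Icc.2 (ht.1.trans ht.2)
  refine ODE_solution_unique_of_mem_Icc_right (v := f) (K := K) (s := fun _ => univ)
    (fun t ht => (hlip t (Ico_subset_Icc_self ht)).lipschitzOnWith)
    hXc (fun _ => hasDerivWithinAt_of_eq_picard hf hXc hX) (fun _ _ => mem_univ _)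
    hYc (fun _ => hasDerivWithinAt_of_eq_picard hf hYc hY) (fun _ _ => mem_univ _) ?_ ht
  rw [hX a ha, hY a ha, ODE.picard_apply₀, ODE.picard_apply₀]

end Picard

section Solvability

variable {d : ℕ} {u : ℝ → Space d → Space d} {W : ℝ → Space d} {s : ℝ} {y : Space d}

lemma isSolution_iff_eq_picard {X : ℝ → Space d} (hW : ContinuousOn W (Icc s 1)) :
    IsSolution u W s y X ↔ ContinuousOn (fun t => X t - (W t - W s)) (Icc s 1) ∧
      ∀ t ∈ Icc s 1, X t - (W t - W s) = ODE.picard (fun t z => u t (z + (W t - W s))) s y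
        (fun t => X t - (W t - W s)) t := by
  have hWs : ContinuousOn (fun t => W t - W s) (Icc s 1) := hW.sub continuousOn_const
  refine and_congr ⟨fun hX => hX.sub hWs, fun hX => ?_⟩ (forall₂_congr fun t _ => ?_)
  · exact (hX.add hWs).congr fun t _ => (sub_add_cancel (X t) _).symm
  · simp only [ODE.picard_apply, sub_add_cancel]
    rw [sub_eq_iff_eq_add]

lemma uniquelySolvable_of_lipschitz
    (hu : ContinuousOn (Function.uncurry u) (Ioc 0 1 ×ˢ univ))
    (hlip : ∀ s ∈ Ioc (0 : ℝ) 1, ∃ K B : ℝ≥0, ∀ t ∈ Icc s 1,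
      LipschitzWith K (u t) ∧ ∀ x, ‖u t x‖ ≤ B) :
    UniquelySolvable u := by
  intro W hW s hs y
  obtain ⟨K, B, hKB⟩ := hlip s hs
  have hsub : Icc s 1 ⊆ Ioc 0 1 := fun t ht => ⟨hs.1.trans_le ht.1, ht.2⟩
  have hWs : ContinuousOn W (Icc s 1) := hW.mono hsub
  set f : ℝ → Space d → Space d := fun t z => u t (z + (W t - W s)) with hf
  have hfcont : ContinuousOn (Function.uncurry f) (Icc s 1 ×ˢ univ) :=
    hu.comp (f := fun p : ℝ × Space d => (p.1, p.2 + (W p.1 - W s)))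
      (continuousOn_fst.prodMk (continuousOn_snd.add
        ((hWs.comp continuousOn_fst fun p hp => hp.1).sub continuousOn_const)))
      fun p hp => ⟨hsub hp.1, mem_univ _⟩
  have hflip : ∀ t ∈ Icc s 1, LipschitzWith K (f t) := fun t ht x z => by
    simpa only [hf, edist_add_right] using (hKB t ht).1 (x + (W t - W s)) (z + (W t - W s))
  obtain ⟨X, hXcont, hX⟩ := exists_eq_picard hs.2 hfcont hflip (fun t ht x => (hKB t ht).2 _) y
  refine ⟨fun t => X t + (W t - W s), ?_, fun Y hY t ht => ?_⟩
  · rw [isSolution_iff_eq_picard hWs]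
    simp only [add_sub_cancel_right]
    exact ⟨hXcont, hX⟩
  · rw [isSolution_iff_eq_picard hWs] at hY
    exact sub_eq_iff_eq_add.1 (eqOn_of_eq_picard hfcont hflip hY.1 hY.2 hXcont hX ht)

lemma UniquelySolvable.isSolution_solution (hu : UniquelySolvable u)
    (hW : ContinuousOn W (Ioc 0 1)) (hs : s ∈ Ioc (0 : ℝ) 1) (y : Space d) :
    IsSolution u W s y (solution u W s y) := by
  obtain ⟨X, hX, -⟩ := hu W hW s hs y
  have hex : ∃ X, IsSolution u W s y X := ⟨X, hX⟩
  rw [solution, dif_pos hex]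
  exact hex.choose_spec

end Solvability

/-! ### The inverse distance under a random shear -/

lemma one_add_mul_sq_ge_one {x : ℝ} (hx : -(1 / 2) ≤ x) :
    1 ≤ (1 + x) * (1 - x / 2 + 3 / 8 * x ^ 2 + |x| ^ 3) ^ 2 := by
  rcases abs_cases x with ⟨habs, h⟩ | ⟨habs, h⟩ <;> rw [habs]
  · have hfactor : 0 ≤ 21 / 8 + 49 / 64 * x - 7 / 64 * x ^ 2 + 7 / 4 * x ^ 3 + x ^ 4 := by
      nlinarith [sq_nonneg (x ^ 2 - 1), pow_nonneg h 3]
    linarith [mul_nonneg (pow_nonneg h 3) hfactor]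
  · have hfactor : 0 ≤ 11 / 8 + 79 / 64 * x - 25 / 64 * x ^ 2 - 1 / 4 * x ^ 3 - x ^ 4 := by
      nlinarith [mul_nonneg (neg_nonneg.2 h.le) (neg_le_iff_add_nonneg.1 hx), sq_nonneg (x ^ 2)]
    linarith [mul_nonneg (pow_nonneg (neg_nonneg.2 h.le) 3) hfactor]

lemma inv_sqrt_one_add_le {x : ℝ} (hx : -(1 / 2) ≤ x) :
    (√(1 + x))⁻¹ ≤ 1 - x / 2 + 3 / 8 * x ^ 2 + |x| ^ 3 := by
  have hpos : 0 < 1 - x / 2 + 3 / 8 * x ^ 2 + |x| ^ 3 := by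
    nlinarith [sq_nonneg (x - 1 / 2), pow_nonneg (abs_nonneg x) 3]
  have hx1 : 0 < 1 + x := by linarith
  rw [inv_le_comm₀ (Real.sqrt_pos.2 hx1) hpos]
  refine Real.le_sqrt_of_sq_le ?_
  rw [inv_pow, inv_le_iff_one_le_mul₀ (by positivity)]
  exact one_add_mul_sq_ge_one hx

section InnerProductSpace

variable {E : Type*} [NormedAddCommGroup E] [InnerProductSpace ℝ E]

lemma abs_two_mul_inner_add_sq_le {D v : E} (hv : ‖v‖ ≤ ‖D‖ / 100) :
    |2 * inner ℝ D v + ‖v‖ ^ 2| ≤ 2.01 * (‖D‖ * ‖v‖) := by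
  have hinner := abs_real_inner_le_norm D v
  calc |2 * inner ℝ D v + ‖v‖ ^ 2| ≤ |2 * inner ℝ D v| + |‖v‖ ^ 2| := abs_add_le _ _
    _ = 2 * |inner ℝ D v| + ‖v‖ * ‖v‖ := by
      rw [abs_mul, abs_two, abs_of_nonneg (sq_nonneg ‖v‖), sq]
    _ ≤ 2.01 * (‖D‖ * ‖v‖) := by
      linarith [mul_le_mul_of_nonneg_right hv (norm_nonneg v)]

lemma inv_norm_add_le {D v : E} (hD : D ≠ 0) (hv : ‖v‖ ≤ ‖D‖ / 100) :
    ‖D + v‖⁻¹ ≤ ‖D‖⁻¹ * (1 - (2 * inner ℝ D v + ‖v‖ ^ 2) / ‖D‖ ^ 2 / 2 +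
      3 / 8 * ((2 * inner ℝ D v + ‖v‖ ^ 2) / ‖D‖ ^ 2) ^ 2 + 8.2 * (‖v‖ / ‖D‖) ^ 3) := by
  have hpos : 0 < ‖D‖ := norm_pos_iff.2 hD
  set x := (2 * inner ℝ D v + ‖v‖ ^ 2) / ‖D‖ ^ 2 with hx
  have habs : |x| ≤ 2.01 * (‖v‖ / ‖D‖) := by
    rw [hx, abs_div, abs_of_nonneg (sq_nonneg ‖D‖), div_le_iff₀ (by positivity)]
    refine (abs_two_mul_inner_add_sq_le hv).trans_eq ?_
    field_simp
  have hratio : ‖v‖ / ‖D‖ ≤ 1 / 100 := by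
    rw [div_le_iff₀ hpos]
    linarith
  have hnorm : ‖D + v‖ = ‖D‖ * √(1 + x) := by
    have hsq : ‖D + v‖ ^ 2 = ‖D‖ ^ 2 * (1 + x) := by
      rw [norm_add_sq_real, hx]
      field_simp
      ring
    rw [← Real.sqrt_sq (norm_nonneg (D + v)), hsq, Real.sqrt_mul (sq_nonneg _),
      Real.sqrt_sq hpos.le]
  have hcube : |x| ^ 3 ≤ 8.2 * (‖v‖ / ‖D‖) ^ 3 := by
    calc |x| ^ 3 ≤ (2.01 * (‖v‖ / ‖D‖)) ^ 3 := by gcongr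
      _ = 2.01 ^ 3 * (‖v‖ / ‖D‖) ^ 3 := mul_pow _ _ _
      _ ≤ 8.2 * (‖v‖ / ‖D‖) ^ 3 := by gcongr; norm_num
  rw [hnorm, mul_inv]
  gcongr
  linarith [inv_sqrt_one_add_le (x := x) (by linarith [(abs_le.1 habs).1])]

lemma inv_norm_add_add_inv_norm_sub_le {D v : E} (hD : D ≠ 0) (hv : ‖v‖ ≤ ‖D‖ / 100) :
    ‖D + v‖⁻¹ + ‖D - v‖⁻¹ ≤ ‖D‖⁻¹ *
      (2 + (3 * inner ℝ D v ^ 2 - ‖D‖ ^ 2 * ‖v‖ ^ 2) / ‖D‖ ^ 4 + 17 * (‖v‖ / ‖D‖) ^ 3) := by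
  have hpos : 0 < ‖D‖ := norm_pos_iff.2 hD
  have hadd := inv_norm_add_le hD hv
  have hsub := inv_norm_add_le hD (v := -v) (by rwa [norm_neg])
  rw [inner_neg_right, norm_neg, ← sub_eq_add_neg] at hsub
  have hratio : ‖v‖ / ‖D‖ ≤ 1 / 100 := by
    rw [div_le_iff₀ hpos]
    linarith
  have hquartic : (‖v‖ / ‖D‖) ^ 4 ≤ 1 / 100 * (‖v‖ / ‖D‖) ^ 3 := by
    rw [pow_succ']
    gcongr
  refine (add_le_add hadd hsub).trans ?_
  rw [← mul_add]
  refine mul_le_mul_of_nonneg_left ?_ (inv_nonneg.2 hpos.le)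
  calc
    _ = 2 + (3 * inner ℝ D v ^ 2 - ‖D‖ ^ 2 * ‖v‖ ^ 2) / ‖D‖ ^ 4 +
        (3 / 4 * (‖v‖ / ‖D‖) ^ 4 + 16.4 * (‖v‖ / ‖D‖) ^ 3) := by
      field_simp
      ring
    _ ≤ _ := by
      linarith [hquartic, show 0 ≤ (‖v‖ / ‖D‖) ^ 3 by positivity]

lemma inv_norm_add_smul_add_inv_norm_sub_smul_le {D e : E} (hD : D ≠ 0) (he : ‖e‖ = 1) {a κ : ℝ}
    (hκ : κ ≤ 1 / 100) (ha : |a| ≤ κ * ‖D‖) :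
    ‖D + a • e‖⁻¹ + ‖D + (-a) • e‖⁻¹ ≤ ‖D‖⁻¹ *
      (2 + a ^ 2 * (3 * inner ℝ D e ^ 2 - ‖D‖ ^ 2) / ‖D‖ ^ 4 + 17 * κ ^ 3) := by
  have hpos : 0 < ‖D‖ := norm_pos_iff.2 hD
  have hnorm : ‖a • e‖ = |a| := by rw [norm_smul, he, mul_one, Real.norm_eq_abs]
  have hpair := inv_norm_add_add_inv_norm_sub_le hD (v := a • e)
    (by rw [hnorm]; linarith [mul_le_mul_of_nonneg_right hκ hpos.le])
  rw [sub_eq_add_neg D, ← neg_smul, hnorm, inner_smul_right, sq_abs] at hpair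
  have hratio : |a| / ‖D‖ ≤ κ := (div_le_iff₀ hpos).2 ha
  refine hpair.trans ?_
  gcongr
  exact le_of_eq (by ring)

lemma sum_inv_norm_add_quarter_turns_le {D e : E} (hD : D ≠ 0) (he : ‖e‖ = 1) {z : ℂ} {κ : ℝ}
    (hκ : κ ≤ 1 / 100) (hz : ‖z‖ ≤ κ * ‖D‖) :
    ∑ l : Fin 4, ‖D + (Complex.I ^ (l : ℕ) * z).im • e‖⁻¹ ≤ ‖D‖⁻¹ *
      (4 + ‖z‖ ^ 2 * (3 * inner ℝ D e ^ 2 - ‖D‖ ^ 2) / ‖D‖ ^ 4 + 34 * κ ^ 3) := by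
  have him := inv_norm_add_smul_add_inv_norm_sub_smul_le hD he hκ
    ((Complex.abs_im_le_norm z).trans hz)
  have hre := inv_norm_add_smul_add_inv_norm_sub_smul_le hD he hκ
    ((Complex.abs_re_le_norm z).trans hz)
  calc ∑ l : Fin 4, ‖D + (Complex.I ^ (l : ℕ) * z).im • e‖⁻¹
      = (‖D + z.im • e‖⁻¹ + ‖D + (-z.im) • e‖⁻¹) +
        (‖D + z.re • e‖⁻¹ + ‖D + (-z.re) • e‖⁻¹) := by
        rw [Fin.sum_univ_four]
        simp [pow_succ]
        ring
    _ ≤ _ := add_le_add him hre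
    _ = _ := by
        rw [Complex.sq_norm, Complex.normSq_apply]
        ring

end InnerProductSpace

/-- The four shear directions: the coordinate axes and the two diagonals. -/
def dir (j : Fin 4) : Space 2 :=
  ![!₂[1, 0], !₂[0, 1], !₂[(√2)⁻¹, (√2)⁻¹], !₂[-(√2)⁻¹, (√2)⁻¹]] j

/-- The unit vectors orthogonal to the shear directions, each of which is again a shear
direction. -/
def nrm (j : Fin 4) : Space 2 := dir (![1, 0, 3, 2] j)

lemma inv_sqrt_two_sq : (√2 : ℝ)⁻¹ ^ 2 = 1 / 2 := by
  rw [inv_pow, Real.sq_sqrt zero_le_two, one_div]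

lemma norm_dir (j : Fin 4) : ‖dir j‖ = 1 := by
  rw [EuclideanSpace.norm_eq, Real.sqrt_eq_one]
  fin_cases j <;> norm_num [dir, Fin.sum_univ_two, inv_sqrt_two_sq]

lemma norm_nrm (j : Fin 4) : ‖nrm j‖ = 1 := norm_dir _

lemma inner_dir_nrm (j : Fin 4) : inner ℝ (dir j) (nrm j) = 0 := by
  fin_cases j <;> simp [dir, nrm, PiLp.inner_apply, Fin.sum_univ_two]

lemma inner_dir_sq (D : Space 2) :
    inner ℝ D (dir 0) ^ 2 = D 0 ^ 2 ∧ inner ℝ D (dir 1) ^ 2 = D 1 ^ 2 ∧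
      inner ℝ D (dir 2) ^ 2 = (D 0 + D 1) ^ 2 / 2 ∧
      inner ℝ D (dir 3) ^ 2 = (D 0 - D 1) ^ 2 / 2 := by
  have hsq := inv_sqrt_two_sq
  refine ⟨?_, ?_, ?_, ?_⟩ <;>
    simp only [dir, PiLp.inner_apply, Fin.sum_univ_two, Matrix.cons_val, RCLike.inner_apply,
      conj_trivial]
  · ring
  · ring
  · linear_combination (D 0 + D 1) ^ 2 * hsq
  · linear_combination (D 0 - D 1) ^ 2 * hsq

lemma inner_dir_sq_add_inner_nrm_sq (D : Space 2) (j : Fin 4) :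
    inner ℝ D (dir j) ^ 2 + inner ℝ D (nrm j) ^ 2 = ‖D‖ ^ 2 := by
  obtain ⟨h0, h1, h2, h3⟩ := inner_dir_sq D
  rw [EuclideanSpace.real_norm_sq_eq, Fin.sum_univ_two]
  fin_cases j <;> simp [nrm, h0, h1, h2, h3] <;> ring

lemma sum_inner_nrm_sq_mul (D : Space 2) :
    ∑ j, inner ℝ D (nrm j) ^ 2 * (3 * inner ℝ D (dir j) ^ 2 - ‖D‖ ^ 2) = -‖D‖ ^ 4 / 2 := by
  obtain ⟨h0, h1, h2, h3⟩ := inner_dir_sq D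
  rw [show ‖D‖ ^ 4 = (‖D‖ ^ 2) ^ 2 by ring, EuclideanSpace.real_norm_sq_eq, Fin.sum_univ_two,
    Fin.sum_univ_four]
  simp [nrm, h0, h1, h2, h3]
  ring

lemma inner_nrm_sq_le (D : Space 2) (j : Fin 4) : inner ℝ D (nrm j) ^ 2 ≤ ‖D‖ ^ 2 := by
  linarith [inner_dir_sq_add_inner_nrm_sq D j, sq_nonneg (inner ℝ D (dir j))]

lemma inner_dir_sq_le (D : Space 2) (j : Fin 4) : inner ℝ D (dir j) ^ 2 ≤ ‖D‖ ^ 2 := by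
  linarith [inner_dir_sq_add_inner_nrm_sq D j, sq_nonneg (inner ℝ D (nrm j))]

lemma drift_le_of_close {D : Space 2} (j : Fin 4) {κ r : ℝ} (hD : D ≠ 0)
    (hle : r ^ 2 ≤ κ ^ 2 * inner ℝ D (nrm j) ^ 2)
    (hge : (1 - 1 / 32) * (κ ^ 2 * inner ℝ D (nrm j) ^ 2) ≤ r ^ 2) :
    r ^ 2 * (3 * inner ℝ D (dir j) ^ 2 - ‖D‖ ^ 2) / ‖D‖ ^ 4 ≤
      κ ^ 2 * (inner ℝ D (nrm j) ^ 2 * (3 * inner ℝ D (dir j) ^ 2 - ‖D‖ ^ 2)) / ‖D‖ ^ 4 +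
        κ ^ 2 / 32 := by
  have : 0 < ‖D‖ := norm_pos_iff.2 hD
  rw [← sub_le_iff_le_add', ← sub_div, div_le_iff₀ (by positivity),
    ← inner_dir_sq_add_inner_nrm_sq D j, show ‖D‖ ^ 4 = (‖D‖ ^ 2) ^ 2 by ring]
  have hnrm : κ ^ 2 * (inner ℝ D (nrm j) ^ 2) ^ 2 ≤ κ ^ 2 * (‖D‖ ^ 2) ^ 2 :=
    mul_le_mul_of_nonneg_left (pow_le_pow_left₀ (sq_nonneg _) (inner_nrm_sq_le D j) 2)
      (sq_nonneg κ)
  linarith [mul_nonneg (sq_nonneg (inner ℝ D (dir j))) (sub_nonneg.2 hle),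
    mul_nonneg (sq_nonneg (inner ℝ D (nrm j))) (sub_nonneg.2 hge)]

lemma drift_le {D : Space 2} (j : Fin 4) {κ r : ℝ} (hD : D ≠ 0)
    (hle : r ^ 2 ≤ κ ^ 2 * inner ℝ D (nrm j) ^ 2) :
    r ^ 2 * (3 * inner ℝ D (dir j) ^ 2 - ‖D‖ ^ 2) / ‖D‖ ^ 4 ≤ 2 * κ ^ 2 := by
  have : 0 < ‖D‖ := norm_pos_iff.2 hD
  rw [div_le_iff₀ (by positivity)]
  calc r ^ 2 * (3 * inner ℝ D (dir j) ^ 2 - ‖D‖ ^ 2) ≤ r ^ 2 * (2 * ‖D‖ ^ 2) := by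
        gcongr
        linarith [inner_dir_sq_le D j]
    _ ≤ κ ^ 2 * ‖D‖ ^ 2 * (2 * ‖D‖ ^ 2) := by
        gcongr
        exact hle.trans (mul_le_mul_of_nonneg_left (inner_nrm_sq_le D j) (sq_nonneg κ))
    _ = 2 * κ ^ 2 * ‖D‖ ^ 4 := by ring

section AverageShear

variable {D : Space 2} {κ : ℝ} {z : Fin 4 → ℂ}

lemma sum_inv_norm_shear_le (hD : D ≠ 0) (h0 : 0 ≤ κ) (hκ : κ ≤ 1 / 100)
    (hz : ∀ j, ‖z j‖ ^ 2 ≤ κ ^ 2 * inner ℝ D (nrm j) ^ 2) :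
    ∑ j, ∑ l : Fin 4, ‖D + (Complex.I ^ (l : ℕ) * z j).im • dir j‖⁻¹ ≤ ‖D‖⁻¹ *
      (16 + ∑ j, ‖z j‖ ^ 2 * (3 * inner ℝ D (dir j) ^ 2 - ‖D‖ ^ 2) / ‖D‖ ^ 4 +
        136 * κ ^ 3) := by
  have hz' (j : Fin 4) : ‖z j‖ ≤ κ * ‖D‖ := by
    refine abs_le_of_sq_le_sq' ?_ (by positivity) |>.2
    rw [mul_pow]
    exact (hz j).trans (mul_le_mul_of_nonneg_left (inner_nrm_sq_le D j) (sq_nonneg κ))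
  refine (Finset.sum_le_sum fun j _ =>
    sum_inv_norm_add_quarter_turns_le hD (norm_dir j) hκ (hz' j)).trans_eq ?_
  rw [← Finset.mul_sum, Finset.sum_add_distrib, Finset.sum_add_distrib]
  simp only [Finset.sum_const, Finset.card_univ, Fintype.card_fin, nsmul_eq_mul]
  ring

lemma average_inv_norm_le_of_close (hD : D ≠ 0) (h0 : 0 ≤ κ) (hκ : κ ≤ 1 / 4000)
    (hle : ∀ j, ‖z j‖ ^ 2 ≤ κ ^ 2 * inner ℝ D (nrm j) ^ 2)
    (hge : ∀ j, (1 - 1 / 32) * (κ ^ 2 * inner ℝ D (nrm j) ^ 2) ≤ ‖z j‖ ^ 2) :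
    (∑ j, ∑ l : Fin 4, ‖D + (Complex.I ^ (l : ℕ) * z j).im • dir j‖⁻¹) / 16 ≤
      (1 - κ ^ 2 / 64) * ‖D‖⁻¹ := by
  have : 0 < ‖D‖ := norm_pos_iff.2 hD
  have hdrift : ∑ j, ‖z j‖ ^ 2 * (3 * inner ℝ D (dir j) ^ 2 - ‖D‖ ^ 2) / ‖D‖ ^ 4 ≤
      -(3 / 8) * κ ^ 2 := by
    refine (Finset.sum_le_sum fun j _ => drift_le_of_close j hD (hle j) (hge j)).trans_eq ?_
    rw [Finset.sum_add_distrib, ← Finset.sum_div, ← Finset.mul_sum, sum_inner_nrm_sq_mul]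
    simp only [Finset.sum_const, Finset.card_univ, Fintype.card_fin, nsmul_eq_mul]
    rw [← mul_div_assoc, div_right_comm, mul_neg, neg_div, mul_div_cancel_right₀ _ (by positivity)]
    ring
  have hcube : κ ^ 3 ≤ κ ^ 2 * (1 / 4000) := by rw [pow_succ]; gcongr
  rw [div_le_iff₀ (by norm_num)]
  calc _ ≤ ‖D‖⁻¹ * (16 + -(3 / 8) * κ ^ 2 + 136 * (κ ^ 2 * (1 / 4000))) :=
        (sum_inv_norm_shear_le hD h0 (hκ.trans (by norm_num)) hle).trans (by gcongr)
    _ ≤ ‖D‖⁻¹ * ((1 - κ ^ 2 / 64) * 16) := by gcongr; linarith [sq_nonneg κ]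
    _ = _ := by ring

lemma average_inv_norm_le_of_far {L : ℝ} (hL : 0 < L) (hfar : L / 4 ≤ ‖D‖) (h0 : 0 ≤ κ)
    (hκ : κ ≤ 1 / 4000) (hle : ∀ j, ‖z j‖ ^ 2 ≤ κ ^ 2 * inner ℝ D (nrm j) ^ 2) :
    (∑ j, ∑ l : Fin 4, ‖D + (Complex.I ^ (l : ℕ) * z j).im • dir j‖⁻¹) / 16 ≤
      (1 - κ ^ 2 / 64) * ‖D‖⁻¹ + 8 * κ ^ 2 / L := by
  have hpos : 0 < ‖D‖ := lt_of_lt_of_le (by positivity) hfar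
  have hD : D ≠ 0 := norm_pos_iff.1 hpos
  have hdrift : ∑ j, ‖z j‖ ^ 2 * (3 * inner ℝ D (dir j) ^ 2 - ‖D‖ ^ 2) / ‖D‖ ^ 4 ≤ 8 * κ ^ 2 := by
    refine (Finset.sum_le_sum fun j _ => drift_le j hD (hle j)).trans_eq ?_
    simp only [Finset.sum_const, Finset.card_univ, Fintype.card_fin, nsmul_eq_mul]
    ring
  have hcube : κ ^ 3 ≤ κ ^ 2 * (1 / 4000) := by rw [pow_succ]; gcongr
  have hinv : ‖D‖⁻¹ ≤ 4 / L := by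
    rw [inv_le_comm₀ hpos (by positivity), inv_div]
    exact hfar
  rw [div_le_iff₀ (by norm_num)]
  calc _ ≤ ‖D‖⁻¹ * (16 + 8 * κ ^ 2 + 136 * (κ ^ 2 * (1 / 4000))) :=
        (sum_inv_norm_shear_le hD h0 (hκ.trans (by norm_num)) hle).trans (by gcongr)
    _ ≤ ‖D‖⁻¹ * ((1 - κ ^ 2 / 64) * 16 + 32 * κ ^ 2) := by
        refine mul_le_mul_of_nonneg_left ?_ (inv_nonneg.2 hpos.le)
        linarith [sq_nonneg κ]
    _ = ((1 - κ ^ 2 / 64) * ‖D‖⁻¹ + 2 * κ ^ 2 * ‖D‖⁻¹) * 16 := by ring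
    _ ≤ ((1 - κ ^ 2 / 64) * ‖D‖⁻¹ + 2 * κ ^ 2 * (4 / L)) * 16 := by gcongr
    _ = _ := by ring

lemma average_inv_norm_le {L : ℝ} (hD : D ≠ 0) (hL : 0 < L) (h0 : 0 ≤ κ) (hκ : κ ≤ 1 / 4000)
    (hle : ∀ j, ‖z j‖ ^ 2 ≤ κ ^ 2 * inner ℝ D (nrm j) ^ 2)
    (hge : ‖D‖ ≤ L / 4 → ∀ j, (1 - 1 / 32) * (κ ^ 2 * inner ℝ D (nrm j) ^ 2) ≤ ‖z j‖ ^ 2) :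
    (∑ j, ∑ l : Fin 4, ‖D + (Complex.I ^ (l : ℕ) * z j).im • dir j‖⁻¹) / 16 ≤
      (1 - κ ^ 2 / 64) * ‖D‖⁻¹ + 8 * κ ^ 2 / L := by
  rcases le_total ‖D‖ (L / 4) with hclose | hfar
  · exact (average_inv_norm_le_of_close hD h0 hκ hle (hge hclose)).trans
      (le_add_of_nonneg_right (by positivity))
  · exact average_inv_norm_le_of_far hL hfar h0 hκ hle

end AverageShear

/-! ### Random alternating shear flows -/

/-- The smooth time profile of a shear of unit duration, supported in `[0, 1]`. -/
def bump : ContDiffBump (1 / 2 : ℝ) where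
  rIn := 1 / 4
  rOut := 1 / 2
  rIn_pos := by norm_num
  rIn_lt_rOut := by norm_num

lemma bump_eq_zero_of_nonpos {x : ℝ} (hx : x ≤ 0) : bump x = 0 :=
  bump.zero_of_le_dist <| by
    rw [Real.dist_eq]
    exact (by linarith : (1 / 2 : ℝ) ≤ -(x - 1 / 2)).trans (neg_le_abs _)

lemma bump_eq_zero_of_one_le {x : ℝ} (hx : 1 ≤ x) : bump x = 0 :=
  bump.zero_of_le_dist <| by
    rw [Real.dist_eq]
    exact (by linarith : (1 / 2 : ℝ) ≤ x - 1 / 2).trans (le_abs_self _)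

/-- The integral of the profile `bump`, so that a shear of duration `T` and maximal speed `A` moves
particles by at most `A * T * bumpMass`. -/
def bumpMass : ℝ := ∫ x in (0 : ℝ)..1, bump x

lemma bumpMass_pos : 0 < bumpMass := by
  refine intervalIntegral.intervalIntegral_pos_of_pos_on
    (bump.continuous.intervalIntegrable _ _) (fun x hx => bump.pos_of_mem_ball ?_) zero_lt_one
  rw [Real.ball_eq_Ioo]
  convert hx using 2 <;> norm_num [bump]

/-- The times at which the shears are switched. The enumeration runs backwards in time: the `n`-th
shear acts between `time (n + 1)` and `time n`. -/
structure SwitchingTimes where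
  time : ℕ → ℝ
  time_zero : time 0 = 1
  time_anti : StrictAnti time
  time_tendsto : Tendsto time atTop (𝓝 0)

namespace SwitchingTimes

variable (S : SwitchingTimes)

/-- The duration of the `n`-th shear. -/
def step (n : ℕ) : ℝ := S.time n - S.time (n + 1)

lemma step_pos (n : ℕ) : 0 < S.step n := sub_pos.2 (S.time_anti n.lt_succ_self)

lemma time_pos (n : ℕ) : 0 < S.time n :=
  (S.time_anti.antitone.le_of_tendsto S.time_tendsto (n + 1)).trans_lt
    (S.time_anti n.lt_succ_self)

lemma time_le_one (n : ℕ) : S.time n ≤ 1 := by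
  rw [← S.time_zero]
  exact S.time_anti.antitone n.zero_le

lemma time_mem_Ioc (n : ℕ) : S.time n ∈ Ioc (0 : ℝ) 1 := ⟨S.time_pos n, S.time_le_one n⟩

lemma exists_time_lt {t : ℝ} (ht : 0 < t) : ∃ n, S.time n < t :=
  (S.time_tendsto.eventually_lt_const ht).exists

lemma exists_mem_Ioc {t : ℝ} (ht : t ∈ Ioc (0 : ℝ) 1) :
    ∃ n, t ∈ Ioc (S.time (n + 1)) (S.time n) := by
  classical
  have hexists := S.exists_time_lt ht.1
  have hspec := Nat.find_spec hexists
  obtain ⟨n, hn⟩ : ∃ n, Nat.find hexists = n + 1 := by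
    refine Nat.exists_eq_succ_of_ne_zero fun h0 => ?_
    rw [h0, S.time_zero] at hspec
    exact hspec.not_ge ht.2
  rw [hn] at hspec
  exact ⟨n, hspec, not_lt.1 (Nat.find_min hexists (hn ▸ n.lt_succ_self))⟩

lemma iUnion_Ioc_time : ⋃ n, Ioc (S.time (n + 1)) (S.time n) = Ioc 0 1 :=
  (iUnion_subset fun n => Ioc_subset_Ioc (S.time_pos _).le (S.time_le_one n)).antisymm
    fun _ ht => mem_iUnion.2 (S.exists_mem_Ioc ht)

/-- The time profile of the `n`-th shear. -/
def cutoff (n : ℕ) (t : ℝ) : ℝ := bump ((t - S.time (n + 1)) / S.step n)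

lemma cutoff_nonneg (n : ℕ) (t : ℝ) : 0 ≤ S.cutoff n t := bump.nonneg

lemma cutoff_le_one (n : ℕ) (t : ℝ) : S.cutoff n t ≤ 1 := bump.le_one

lemma norm_cutoff_le_one (n : ℕ) (t : ℝ) : ‖S.cutoff n t‖ ≤ 1 := by
  rw [Real.norm_of_nonneg (S.cutoff_nonneg n t)]
  exact S.cutoff_le_one n t

lemma cutoff_eq_zero_of_le {n : ℕ} {t : ℝ} (ht : t ≤ S.time (n + 1)) : S.cutoff n t = 0 :=
  bump_eq_zero_of_nonpos (div_nonpos_of_nonpos_of_nonneg (sub_nonpos.2 ht) (S.step_pos n).le)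

lemma cutoff_eq_zero_of_ge {n : ℕ} {t : ℝ} (ht : S.time n ≤ t) : S.cutoff n t = 0 :=
  bump_eq_zero_of_one_le ((one_le_div (S.step_pos n)).2 (sub_le_sub_right ht _))

lemma contDiff_cutoff (n : ℕ) : ContDiff ℝ ((⊤ : ℕ∞) : WithTop ℕ∞) (S.cutoff n) :=
  bump.contDiff.comp ((contDiff_id.sub contDiff_const).div_const _)

lemma continuous_cutoff (n : ℕ) : Continuous (S.cutoff n) := (S.contDiff_cutoff n).continuous

lemma integral_cutoff (n : ℕ) :
    ∫ t in S.time (n + 1)..S.time n, S.cutoff n t = S.step n * bumpMass := by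
  have hstep := (S.step_pos n).ne'
  simp only [cutoff, sub_div]
  rw [intervalIntegral.integral_comp_div_sub _ hstep, sub_self, ← sub_div, ← step, div_self hstep,
    smul_eq_mul, bumpMass]

lemma cutoff_eq_zero_of_ne {m n : ℕ} {t : ℝ} (ht : t ∈ Icc (S.time (n + 1)) (S.time n))
    (hmn : m ≠ n) : S.cutoff m t = 0 := by
  rcases lt_or_gt_of_ne hmn with hlt | hgt
  · exact S.cutoff_eq_zero_of_le (ht.2.trans (S.time_anti.antitone hlt))
  · exact S.cutoff_eq_zero_of_ge ((S.time_anti.antitone hgt).trans ht.1)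

lemma exists_forall_ne_cutoff_eq_zero (t : ℝ) : ∃ n, ∀ m ≠ n, S.cutoff m t = 0 := by
  by_cases ht : t ∈ Ioc (0 : ℝ) 1
  · obtain ⟨n, hn⟩ := S.exists_mem_Ioc ht
    exact ⟨n, fun m => S.cutoff_eq_zero_of_ne (Ioc_subset_Icc_self hn)⟩
  · refine ⟨0, fun m _ => ?_⟩
    rw [mem_Ioc, not_and_or, not_lt, not_le] at ht
    rcases ht with hneg | hlarge
    · exact S.cutoff_eq_zero_of_le (hneg.trans (S.time_pos _).le)
    · exact S.cutoff_eq_zero_of_ge ((S.time_le_one m).trans hlarge.le)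

section PulseSum

variable {E : Type*} [NormedAddCommGroup E] [NormedSpace ℝ E]

/-- The superposition of the time profiles with coefficients `g`. -/
def pulseSum (g : ℕ → E) (t : ℝ) : E := ∑' n, S.cutoff n t • g n

lemma pulseSum_eq_sum (g : ℕ → E) {N : ℕ} {t : ℝ} (ht : S.time N ≤ t) :
    S.pulseSum g t = ∑ n ∈ Finset.range N, S.cutoff n t • g n := by
  refine tsum_eq_sum fun n hn => ?_
  rw [S.cutoff_eq_zero_of_ge, zero_smul]
  exact (S.time_anti.antitone (not_lt.1 (mt Finset.mem_range.2 hn))).trans ht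

lemma pulseSum_eq_smul (g : ℕ → E) {n : ℕ} {t : ℝ} (h : ∀ m ≠ n, S.cutoff m t = 0) :
    S.pulseSum g t = S.cutoff n t • g n :=
  tsum_eq_single n fun m hm => by rw [h m hm, zero_smul]

lemma pulseSum_of_mem_Icc (g : ℕ → E) {n : ℕ} {t : ℝ}
    (ht : t ∈ Icc (S.time (n + 1)) (S.time n)) : S.pulseSum g t = S.cutoff n t • g n :=
  S.pulseSum_eq_smul g fun _ => S.cutoff_eq_zero_of_ne ht

lemma continuousOn_pulseSum (g : ℕ → E) : ContinuousOn (S.pulseSum g) (Ioc 0 1) := by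
  intro t ht
  obtain ⟨N, hN⟩ := S.exists_time_lt ht.1
  have hsum : Continuous fun t => ∑ n ∈ Finset.range N, S.cutoff n t • g n :=
    continuous_finsetSum _ fun n _ => (S.continuous_cutoff n).smul continuous_const
  refine (hsum.continuousAt.congr ?_).continuousWithinAt
  filter_upwards [Ioi_mem_nhds hN] with r hr
  exact (S.pulseSum_eq_sum g (le_of_lt hr)).symm

lemma norm_pulseSum_le (g : ℕ → E) {n : ℕ} {t : ℝ}
    (ht : t ∈ Icc (S.time (n + 1)) (S.time n)) : ‖S.pulseSum g t‖ ≤ ‖g n‖ := by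
  rw [S.pulseSum_of_mem_Icc g ht, norm_smul]
  exact mul_le_of_le_one_left (norm_nonneg _) (S.norm_cutoff_le_one n t)

lemma integrableOn_pulseSum_Ioc (g : ℕ → E) (n : ℕ) :
    IntegrableOn (S.pulseSum g) (Ioc (S.time (n + 1)) (S.time n)) :=
  Integrable.of_bound (((S.continuousOn_pulseSum g).mono (Ioc_subset_Ioc (S.time_pos (n + 1)).le
    (S.time_le_one n))).aestronglyMeasurable measurableSet_Ioc) ‖g n‖
    (ae_restrict_of_forall_mem measurableSet_Ioc fun _ ht =>
      S.norm_pulseSum_le g (Ioc_subset_Icc_self ht))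

lemma setIntegral_norm_pulseSum_le (g : ℕ → E) (n : ℕ) :
    ∫ t in Ioc (S.time (n + 1)) (S.time n), ‖S.pulseSum g t‖ ≤ ‖g n‖ * S.step n :=
  calc ∫ t in Ioc (S.time (n + 1)) (S.time n), ‖S.pulseSum g t‖
      ≤ ∫ _ in Ioc (S.time (n + 1)) (S.time n), ‖g n‖ :=
        setIntegral_mono_on (S.integrableOn_pulseSum_Ioc g n).norm
          (integrableOn_const (by simp) (by simp)) measurableSet_Ioc
          fun _ ht => S.norm_pulseSum_le g (Ioc_subset_Icc_self ht)
    _ = ‖g n‖ * S.step n := by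
        rw [setIntegral_const, smul_eq_mul, measureReal_def, Real.volume_Ioc, ← step,
          ENNReal.toReal_ofReal (S.step_pos n).le, mul_comm]

lemma integrableOn_pulseSum {g : ℕ → E} (hsum : Summable fun n => ‖g n‖ * S.step n) :
    IntegrableOn (S.pulseSum g) (Icc 0 1) := by
  refine IntegrableOn.congr_set_ae ?_ Ioc_ae_eq_Icc.symm
  rw [← S.iUnion_Ioc_time]
  exact integrableOn_iUnion_of_summable_integral_norm (S.integrableOn_pulseSum_Ioc g)
    (hsum.of_nonneg_of_le (fun n => integral_nonneg fun t => norm_nonneg _)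
      (S.setIntegral_norm_pulseSum_le g))

end PulseSum

end SwitchingTimes

/-- Switching times together with the amplitudes and the length scales of the shears. -/
structure Schedule extends SwitchingTimes where
  amp : ℕ → ℝ
  len : ℕ → ℝ
  amp_nonneg : ∀ n, 0 ≤ amp n
  len_pos : ∀ n, 0 < len n

namespace Schedule

variable (S : Schedule)

/-- The `n`-th shear. Its direction is `dir k.1`, and `k.2` quarter turns are added to its phase. -/
def wave (n : ℕ) (k : Fin 4 × Fin 4) : Space 2 → Space 2 :=
  planeWave ((S.len n)⁻¹ • nrm k.1) (k.2 * (Real.pi / 2)) (S.amp n • dir k.1)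

/-- The random velocity field; `ω n` is the direction and the phase of the `n`-th shear. -/
def field (ω : ℕ → Fin 4 × Fin 4) (t : ℝ) (x : Space 2) : Space 2 :=
  S.pulseSum (fun n => S.wave n (ω n) x) t

variable (ω : ℕ → Fin 4 × Fin 4)

lemma norm_frequency (n : ℕ) (j : Fin 4) : ‖(S.len n)⁻¹ • nrm j‖ = (S.len n)⁻¹ := by
  rw [norm_smul, norm_nrm, mul_one, Real.norm_of_nonneg (inv_pos.2 (S.len_pos n)).le]

lemma norm_amplitude (n : ℕ) (j : Fin 4) : ‖S.amp n • dir j‖ = S.amp n := by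
  rw [norm_smul, norm_dir, mul_one, Real.norm_of_nonneg (S.amp_nonneg n)]

lemma norm_wave_le (n : ℕ) (k : Fin 4 × Fin 4) (x : Space 2) : ‖S.wave n k x‖ ≤ S.amp n :=
  (norm_planeWave_le _ _ _ x).trans (S.norm_amplitude n k.1).le

lemma lipschitzWith_wave (n : ℕ) (k : Fin 4 × Fin 4) :
    LipschitzWith ((S.len n)⁻¹ * S.amp n).toNNReal (S.wave n k) := by
  have hconst : ‖(S.len n)⁻¹ • nrm k.1‖₊ * ‖S.amp n • dir k.1‖₊ =
      ((S.len n)⁻¹ * S.amp n).toNNReal := by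
    rw [Real.toNNReal_mul (inv_pos.2 (S.len_pos n)).le, ← norm_toNNReal, ← norm_toNNReal,
      norm_frequency, norm_amplitude]
  exact (lipschitzWith_planeWave _ _ _).weaken hconst.le

lemma contDiff_wave (n : ℕ) (k : Fin 4 × Fin 4) {m : WithTop ℕ∞} : ContDiff ℝ m (S.wave n k) :=
  contDiff_planeWave _ _ _

lemma smoothPositiveTimes_field : SmoothPositiveTimes (S.field ω) := by
  rintro ⟨t, x⟩ ⟨ht, -⟩
  obtain ⟨N, hN⟩ := S.exists_time_lt ht.1
  have hsum : ContDiff ℝ ((⊤ : ℕ∞) : WithTop ℕ∞) (fun p : ℝ × Space 2 =>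
      ∑ n ∈ Finset.range N, S.cutoff n p.1 • S.wave n (ω n) p.2) :=
    ContDiff.sum fun n _ => ((S.contDiff_cutoff n).comp contDiff_fst).smul
      ((S.contDiff_wave n _).comp contDiff_snd)
  refine (hsum.contDiffAt.congr_of_eventuallyEq ?_).contDiffWithinAt
  have hmem : {p : ℝ × Space 2 | S.time N < p.1} ∈ 𝓝 (t, x) :=
    (isOpen_lt continuous_const continuous_fst).mem_nhds hN
  filter_upwards [hmem] with p hp
  exact S.pulseSum_eq_sum _ (le_of_lt hp)

lemma field_eq_sum {N : ℕ} {t : ℝ} (ht : S.time N ≤ t) :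
    S.field ω t = fun x => ∑ n ∈ Finset.range N, S.cutoff n t • S.wave n (ω n) x :=
  funext fun _ => S.pulseSum_eq_sum _ ht

lemma lipschitzWith_field {N : ℕ} {t : ℝ} (ht : S.time N ≤ t) :
    LipschitzWith (∑ n ∈ Finset.range N, ((S.len n)⁻¹ * S.amp n).toNNReal) (S.field ω t) := by
  rw [S.field_eq_sum ω ht]
  refine LipschitzWith.of_dist_le_mul fun x y => ?_
  rw [NNReal.coe_sum, Finset.sum_mul]
  refine (dist_sum_sum_le _ _ _).trans (Finset.sum_le_sum fun n _ => ?_)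
  rw [dist_smul₀]
  exact (mul_le_of_le_one_left dist_nonneg (S.norm_cutoff_le_one n t)).trans
    ((S.lipschitzWith_wave n _).dist_le_mul x y)

lemma norm_field_le {N : ℕ} {t : ℝ} (ht : S.time N ≤ t) (x : Space 2) :
    ‖S.field ω t x‖ ≤ ∑ n ∈ Finset.range N, S.amp n := by
  rw [S.field_eq_sum ω ht]
  refine (norm_sum_le _ _).trans (Finset.sum_le_sum fun n _ => ?_)
  rw [norm_smul]
  exact (mul_le_of_le_one_left (norm_nonneg _) (S.norm_cutoff_le_one n t)).trans
    (S.norm_wave_le n _ x)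

lemma uniquelySolvable_field : UniquelySolvable (S.field ω) := by
  refine uniquelySolvable_of_lipschitz (S.smoothPositiveTimes_field ω).continuousOn fun s hs => ?_
  obtain ⟨N, hN⟩ := S.exists_time_lt hs.1
  exact ⟨_, ⟨_, Finset.sum_nonneg fun n (_ : n ∈ Finset.range N) => S.amp_nonneg n⟩, fun t ht =>
    ⟨S.lipschitzWith_field ω (hN.le.trans ht.1), S.norm_field_le ω (hN.le.trans ht.1)⟩⟩

lemma cNorm_field_le {α : ℝ} (hα : α ≤ 1) (hlen : ∀ n, S.len n ≤ 1)
    (hamp : ∀ n, S.amp n ≤ S.len n ^ α / 2) (t : ℝ) : cNorm α (S.field ω t) ≤ 2 := by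
  obtain ⟨n, hn⟩ := S.exists_forall_ne_cutoff_eq_zero t
  have hfield : S.field ω t = planeWave ((S.len n)⁻¹ • nrm (ω n).1) ((ω n).2 * (Real.pi / 2))
      ((S.cutoff n t * S.amp n) • dir (ω n).1) := by
    funext x
    rw [field, S.pulseSum_eq_smul _ hn, wave, planeWave, planeWave, smul_comm, mul_smul]
  have hlen0 := S.len_pos n
  have hfreq : 1 ≤ ‖(S.len n)⁻¹ • nrm (ω n).1‖ := by
    rw [norm_frequency]
    exact (one_le_inv₀ hlen0).2 (hlen n)
  rw [hfield]
  refine (cNorm_planeWave_le hfreq hα _ _).trans (ENNReal.ofReal_le_of_le_toReal ?_)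
  rw [norm_frequency, norm_smul, norm_dir, mul_one, norm_mul, Real.norm_of_nonneg (S.amp_nonneg n),
    Real.inv_rpow hlen0.le]
  calc 3 * (S.len n ^ α)⁻¹ * (‖S.cutoff n t‖ * S.amp n)
      ≤ 3 * (S.len n ^ α)⁻¹ * (S.len n ^ α / 2) := by
        gcongr
        exact (mul_le_of_le_one_left (S.amp_nonneg n) (S.norm_cutoff_le_one n t)).trans (hamp n)
    _ = 3 / 2 := by field_simp
    _ ≤ (2 : ℝ≥0∞).toReal := by norm_num

lemma measurable_field (t : ℝ) (x : Space 2) : Measurable fun ω => S.field ω t x := by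
  obtain ⟨n, hn⟩ := S.exists_forall_ne_cutoff_eq_zero t
  simp only [field, S.pulseSum_eq_smul _ hn]
  exact (Measurable.of_discrete (f := fun k => S.cutoff n t • S.wave n k x)).comp
    (measurable_pi_apply n)

lemma memL1C0_field (hsum : Summable fun n => S.amp n * S.step n) : MemL1C0 (S.field ω) := by
  let g (n : ℕ) : BoundedContinuousFunction (Space 2) (Space 2) :=
    BoundedContinuousFunction.ofNormedAddCommGroup (S.wave n (ω n))
      (S.contDiff_wave n _ (m := 0)).continuous (S.amp n) (S.norm_wave_le n _)
  have hg : ∀ n, ‖g n‖ ≤ S.amp n := fun n =>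
    BoundedContinuousFunction.norm_ofNormedAddCommGroup_le _ (S.amp_nonneg n) _
  have hsum' : Summable fun n => ‖g n‖ * S.step n :=
    hsum.of_nonneg_of_le (fun n => mul_nonneg (norm_nonneg _) (S.step_pos n).le)
      fun n => mul_le_mul_of_nonneg_right (hg n) (S.step_pos n).le
  refine ⟨S.pulseSum g, S.integrableOn_pulseSum hsum', Eventually.of_forall fun t x => ?_⟩
  obtain ⟨n, hn⟩ := S.exists_forall_ne_cutoff_eq_zero t
  rw [field, S.pulseSum_eq_smul _ hn, S.pulseSum_eq_smul _ hn]
  rfl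

end Schedule

/-! ### The flow map of a shear -/

lemma norm_exp_mul_I_sub (a b : ℝ) :
    ‖Complex.exp (a * Complex.I) - Complex.exp (b * Complex.I)‖ =
      ‖Complex.exp (Complex.I * (a - b : ℝ)) - 1‖ := by
  have hfactor : Complex.exp (a * Complex.I) - Complex.exp (b * Complex.I) =
      Complex.exp (b * Complex.I) * (Complex.exp (Complex.I * (a - b : ℝ)) - 1) := by
    rw [mul_sub, mul_one, ← Complex.exp_add]
    push_cast
    ring_nf
  rw [hfactor, norm_mul, Complex.norm_exp_ofReal_mul_I, one_mul]

lemma norm_exp_mul_I_sub_le (a b : ℝ) :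
    ‖Complex.exp (a * Complex.I) - Complex.exp (b * Complex.I)‖ ≤ |a - b| := by
  rw [norm_exp_mul_I_sub]
  exact Real.norm_exp_I_mul_ofReal_sub_one_le

lemma le_norm_exp_mul_I_sub {a b : ℝ} (hab : |a - b| ≤ 1 / 4) :
    (1 - 1 / 256) * |a - b| ≤ ‖Complex.exp (a * Complex.I) - Complex.exp (b * Complex.I)‖ := by
  rw [norm_exp_mul_I_sub, Complex.norm_exp_I_mul_ofReal_sub_one, norm_mul, Real.norm_ofNat,
    Real.norm_eq_abs]
  set v := (a - b) / 2 with hv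
  have habs : |a - b| = 2 * |v| := by rw [hv, abs_div, Nat.abs_ofNat, mul_div_cancel₀ _ two_ne_zero]
  have hsin : |v| - |Real.sin v| ≤ |v| ^ 3 / 6 :=
    (abs_sub_abs_le_abs_sub _ _).trans (Real.abs_sub_sin_le v)
  have hcube : |v| ^ 3 ≤ |v| * (1 / 8) ^ 2 := by
    rw [pow_succ']
    gcongr
    linarith
  linarith [abs_nonneg v]

lemma im_I_pow_mul_exp (l : Fin 4) (a : ℝ) :
    (Complex.I ^ (l : ℕ) * Complex.exp (a * Complex.I)).im = Real.sin (a + l * (Real.pi / 2)) := by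
  have hquarter : Complex.I ^ (l : ℕ) = Complex.exp ((l * (Real.pi / 2) : ℝ) * Complex.I) := by
    conv_lhs => rw [← Complex.exp_pi_div_two_mul_I, ← Complex.exp_nat_mul]
    push_cast
    ring_nf
  rw [hquarter, ← Complex.exp_add, ← add_mul, ← Complex.ofReal_add, Complex.exp_ofReal_mul_I_im,
    add_comm]

namespace Schedule

variable (S : Schedule) (W : ℝ → Space 2)

/-- The effective duration of the `n`-th shear. -/
def duration (n : ℕ) : ℝ := S.step n * bumpMass

/-- The strength of the `n`-th shear: the Lipschitz constant of the displacement which it causes. -/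
def strength (n : ℕ) : ℝ := S.amp n * S.duration n / S.len n

/-- The phase of the `n`-th shear in direction `j` at the point `x`, quarter turns not included. -/
def phase (n : ℕ) (j : Fin 4) (x : Space 2) : ℝ := inner ℝ x ((S.len n)⁻¹ • nrm j)

/-- The phase accumulated along the driving path in the course of the `n`-th shear. -/
def phaseShift (n : ℕ) (j : Fin 4) (r : ℝ) : ℝ := S.phase n j (W r - W (S.time (n + 1)))

/-- The complex factor by which the driving path changes the effect of the `n`-th shear: it equals
`duration n` if the path is constant. -/
def response (n : ℕ) (j : Fin 4) : ℂ :=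
  ∫ r in S.time (n + 1)..S.time n,
    S.cutoff n r * Complex.exp (S.phaseShift W n j r * Complex.I)

/-- The flow map from time `S.time (n + 1)` to time `S.time n`. -/
def stepMap (n : ℕ) (k : Fin 4 × Fin 4) (x : Space 2) : Space 2 :=
  x + (W (S.time n) - W (S.time (n + 1))) +
    (S.amp n * (Complex.I ^ (k.2 : ℕ) *
      (Complex.exp (S.phase n k.1 x * Complex.I) * S.response W n k.1)).im) • dir k.1

/-- The composition of the flow maps of `k` shears, ending at time `S.time n`. -/
def flow (ω : ℕ → Fin 4 × Fin 4) : ℕ → ℕ → Space 2 → Space 2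
  | 0, _, x => x
  | k + 1, n, x => S.stepMap W n (ω n) (flow ω k (n + 1) x)

/-- The relative displacement of the points `x` and `y` by the `n`-th shear in direction `j`; its
imaginary part belongs to phase zero, and multiplication by `I` adds a quarter turn. -/
def displacement (n : ℕ) (j : Fin 4) (x y : Space 2) : ℂ :=
  S.amp n * ((Complex.exp (S.phase n j x * Complex.I) -
    Complex.exp (S.phase n j y * Complex.I)) * S.response W n j)

variable {W}

lemma duration_pos (n : ℕ) : 0 < S.duration n := mul_pos (S.step_pos n) bumpMass_pos

lemma strength_nonneg (n : ℕ) : 0 ≤ S.strength n :=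
  div_nonneg (mul_nonneg (S.amp_nonneg n) (S.duration_pos n).le) (S.len_pos n).le

lemma time_succ_le (n : ℕ) : S.time (n + 1) ≤ S.time n := (S.time_anti n.lt_succ_self).le

lemma continuousOn_phaseShift (hW : ContinuousOn W (Icc 0 1)) (n : ℕ) (j : Fin 4) :
    ContinuousOn (S.phaseShift W n j) (Icc (S.time (n + 1)) (S.time n)) :=
  ((hW.mono (Icc_subset_Icc (S.time_pos _).le (S.time_le_one n))).sub
    continuousOn_const).inner (𝕜 := ℝ) continuousOn_const

lemma intervalIntegrable_response (hW : ContinuousOn W (Icc 0 1)) (n : ℕ) (j : Fin 4) :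
    IntervalIntegrable
      (fun r => S.cutoff n r * Complex.exp (S.phaseShift W n j r * Complex.I)) volume
      (S.time (n + 1)) (S.time n) := by
  refine ContinuousOn.intervalIntegrable ?_
  rw [uIcc_of_le (S.time_succ_le n)]
  exact (Complex.continuous_ofReal.comp (S.continuous_cutoff n)).continuousOn.mul
    ((Complex.continuous_ofReal.comp_continuousOn (S.continuousOn_phaseShift hW n j)).mul
      continuousOn_const).cexp

lemma integral_cutoff_mul_sin (hW : ContinuousOn W (Icc 0 1)) (n : ℕ) (k : Fin 4 × Fin 4)
    (a : ℝ) :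
    ∫ r in S.time (n + 1)..S.time n,
        S.cutoff n r * Real.sin (a + S.phaseShift W n k.1 r + k.2 * (Real.pi / 2)) =
      (Complex.I ^ (k.2 : ℕ) *
        (Complex.exp (a * Complex.I) * S.response W n k.1)).im := by
  rw [response, ← mul_assoc, ← intervalIntegral.integral_const_mul, ← Complex.imCLM_apply,
    ← Complex.imCLM.intervalIntegral_comp_comm
      ((S.intervalIntegrable_response hW n k.1).const_mul _)]
  refine intervalIntegral.integral_congr fun r _ => ?_
  simp only [Complex.imCLM_apply]
  rw [← im_I_pow_mul_exp, ← Complex.im_ofReal_mul, Complex.ofReal_add, add_mul, Complex.exp_add]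
  ring_nf

lemma solution_increment {ω : ℕ → Fin 4 × Fin 4} {s : ℝ} {y : Space 2}
    {X : ℝ → Space 2} (hX : IsSolution (S.field ω) W s y X) (hs : 0 < s) {n : ℕ}
    (hsn : s ≤ S.time (n + 1)) {t : ℝ} (ht : t ∈ Icc (S.time (n + 1)) (S.time n)) :
    X t = X (S.time (n + 1)) + (W t - W (S.time (n + 1))) +
      (S.amp n * ∫ r in S.time (n + 1)..t, S.cutoff n r *
        Real.sin (S.phase n (ω n).1 (X r) + (ω n).2 * (Real.pi / 2))) • dir (ω n).1 := by
  have hcont : ContinuousOn (fun r => S.field ω r (X r)) (Icc s 1) :=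
    ContinuousOn.comp (g := fun p : ℝ × Space 2 => S.field ω p.1 p.2) (f := fun r => (r, X r))
      (S.smoothPositiveTimes_field ω).continuousOn (continuousOn_id.prodMk hX.1)
      fun t ht => ⟨⟨hs.trans_le ht.1, ht.2⟩, mem_univ _⟩
  have hint : ∀ a ∈ Icc s 1, ∀ b ∈ Icc s 1,
      IntervalIntegrable (fun r => S.field ω r (X r)) volume a b := fun a ha b hb =>
    (hcont.mono (uIcc_subset_Icc ha hb)).intervalIntegrable
  have hmem₀ : s ∈ Icc s 1 := ⟨le_rfl, hsn.trans (S.time_le_one _)⟩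
  have hmem₁ : S.time (n + 1) ∈ Icc s 1 := ⟨hsn, S.time_le_one _⟩
  have hmem : t ∈ Icc s 1 := ⟨hsn.trans ht.1, ht.2.trans (S.time_le_one n)⟩
  have hfield : ∫ r in S.time (n + 1)..t, S.field ω r (X r) =
      ∫ r in S.time (n + 1)..t, (S.cutoff n r *
        Real.sin (S.phase n (ω n).1 (X r) + (ω n).2 * (Real.pi / 2))) •
          (S.amp n • dir (ω n).1) := by
    refine intervalIntegral.integral_congr fun r hr => ?_
    rw [uIcc_of_le ht.1] at hr
    beta_reduce
    rw [field, S.pulseSum_of_mem_Icc _ ⟨hr.1, hr.2.trans ht.2⟩, wave, planeWave, mul_smul, phase]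
  rw [intervalIntegral.integral_smul_const, smul_smul, mul_comm] at hfield
  rw [hX.2 t hmem, hX.2 _ hmem₁, ← intervalIntegral.integral_add_adjacent_intervals
    (hint s hmem₀ _ hmem₁) (hint _ hmem₁ t hmem), hfield]
  abel

lemma solution_step (hW : ContinuousOn W (Icc 0 1)) {ω : ℕ → Fin 4 × Fin 4} {s : ℝ} {y : Space 2}
    {X : ℝ → Space 2} (hX : IsSolution (S.field ω) W s y X) (hs : 0 < s) {n : ℕ}
    (hsn : s ≤ S.time (n + 1)) :
    X (S.time n) = S.stepMap W n (ω n) (X (S.time (n + 1))) := by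
  -- a shear moves particles orthogonally to its frequency vector, so their phase changes only
  -- through the driving path
  have hphase : ∀ t ∈ Icc (S.time (n + 1)) (S.time n), S.phase n (ω n).1 (X t) =
      S.phase n (ω n).1 (X (S.time (n + 1))) + S.phaseShift W n (ω n).1 t := by
    intro t ht
    rw [phase, S.solution_increment hX hs hsn ht, inner_add_left, inner_add_left,
      inner_smul_left, inner_smul_right (dir (ω n).1), inner_dir_nrm, mul_zero, mul_zero, add_zero]
    rfl
  rw [S.solution_increment hX hs hsn (right_mem_Icc.2 (S.time_succ_le n)), stepMap,
    ← S.integral_cutoff_mul_sin hW]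
  refine congrArg (fun z => _ + (S.amp n * z) • dir (ω n).1)
    (intervalIntegral.integral_congr fun r hr => ?_)
  rw [uIcc_of_le (S.time_succ_le n)] at hr
  rw [hphase r hr]

lemma solution_eq_flow (hW : ContinuousOn W (Icc 0 1)) (ω : ℕ → Fin 4 × Fin 4) (y : Space 2)
    (k n : ℕ) : solution (S.field ω) W (S.time (n + k)) y (S.time n) = S.flow W ω k n y := by
  have hX := (S.uniquelySolvable_field ω).isSolution_solution (hW.mono Ioc_subset_Icc_self)
    (S.time_mem_Ioc (n + k)) y
  generalize hm : n + k = m at hX ⊢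
  induction k generalizing n with
  | zero =>
    obtain rfl : n = m := hm
    rw [hX.2 _ ⟨le_rfl, S.time_le_one _⟩, flow, intervalIntegral.integral_same, sub_self, add_zero,
      add_zero]
  | succ k ih =>
    have hle : S.time m ≤ S.time (n + 1) := S.time_anti.antitone (by lia)
    rw [S.solution_step hW hX (S.time_pos m) hle, flow, ih (n + 1) (by lia)]

lemma phase_sub (n : ℕ) (j : Fin 4) (x y : Space 2) :
    S.phase n j x - S.phase n j y = inner ℝ (x - y) (nrm j) / S.len n := by
  rw [phase, phase, ← inner_sub_left, inner_smul_right, inv_mul_eq_div]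

lemma abs_phase_le (n : ℕ) (j : Fin 4) (x : Space 2) : |S.phase n j x| ≤ ‖x‖ / S.len n := by
  refine (abs_real_inner_le_norm _ _).trans_eq ?_
  rw [norm_frequency, div_eq_mul_inv]

lemma norm_response_le (n : ℕ) (j : Fin 4) : ‖S.response W n j‖ ≤ S.duration n := by
  refine (intervalIntegral.norm_integral_le_integral_norm (S.time_succ_le n)).trans_eq ?_
  rw [duration, ← SwitchingTimes.integral_cutoff]
  refine intervalIntegral.integral_congr fun r _ => ?_
  rw [norm_mul, Complex.norm_exp_ofReal_mul_I, mul_one, Complex.norm_real,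
    Real.norm_of_nonneg (S.cutoff_nonneg n r)]

lemma le_norm_response (hW : ContinuousOn W (Icc 0 1)) (n : ℕ) (j : Fin 4)
    (hsmall : ∀ r ∈ Icc (S.time (n + 1)) (S.time n),
      ‖W r - W (S.time (n + 1))‖ ≤ S.len n / 8) :
    (1 - 1 / 128) * S.duration n ≤ ‖S.response W n j‖ := by
  have hint := S.intervalIntegrable_response hW n j
  refine le_trans ?_ (Complex.re_le_norm _)
  rw [duration, ← SwitchingTimes.integral_cutoff, ← intervalIntegral.integral_const_mul, response,
    ← Complex.reCLM_apply, ← Complex.reCLM.intervalIntegral_comp_comm hint]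
  refine intervalIntegral.integral_mono_on (S.time_succ_le n)
    (((S.continuous_cutoff n).intervalIntegrable _ _).const_mul _)
    ⟨Complex.reCLM.integrable_comp hint.1, Complex.reCLM.integrable_comp hint.2⟩ fun r hr => ?_
  have hshift : |S.phaseShift W n j r| ≤ 1 / 8 :=
    (S.abs_phase_le n j _).trans ((div_le_iff₀ (S.len_pos n)).2 (by linarith [hsmall r hr]))
  have hsq : S.phaseShift W n j r ^ 2 ≤ (1 / 8) ^ 2 := by
    rw [← sq_abs]
    gcongr
  rw [Complex.reCLM_apply, Complex.re_ofReal_mul, Complex.exp_ofReal_mul_I_re, mul_comm]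
  exact mul_le_mul_of_nonneg_left
    (by linarith [Real.one_sub_sq_div_two_le_cos (x := S.phaseShift W n j r)])
    (S.cutoff_nonneg n r)

lemma norm_displacement (n : ℕ) (j : Fin 4) (x y : Space 2) :
    ‖S.displacement W n j x y‖ = S.amp n * (‖Complex.exp (S.phase n j x * Complex.I) -
      Complex.exp (S.phase n j y * Complex.I)‖ * ‖S.response W n j‖) := by
  rw [displacement, norm_mul, norm_mul, Complex.norm_real, Real.norm_of_nonneg (S.amp_nonneg n)]

lemma strength_mul_abs_inner (n : ℕ) (j : Fin 4) (x y : Space 2) :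
    S.strength n * |inner ℝ (x - y) (nrm j)| =
      S.amp n * (|S.phase n j x - S.phase n j y| * S.duration n) := by
  rw [phase_sub, abs_div, abs_of_pos (S.len_pos n), strength]
  ring

lemma norm_displacement_le (n : ℕ) (j : Fin 4) (x y : Space 2) :
    ‖S.displacement W n j x y‖ ≤ S.strength n * |inner ℝ (x - y) (nrm j)| := by
  rw [norm_displacement, strength_mul_abs_inner]
  exact mul_le_mul_of_nonneg_left (mul_le_mul (norm_exp_mul_I_sub_le _ _) (S.norm_response_le n j)
    (norm_nonneg _) (abs_nonneg _)) (S.amp_nonneg n)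

lemma le_norm_displacement (hW : ContinuousOn W (Icc 0 1)) {n : ℕ}
    (hsmall : ∀ r ∈ Icc (S.time (n + 1)) (S.time n),
      ‖W r - W (S.time (n + 1))‖ ≤ S.len n / 8) (j : Fin 4) {x y : Space 2}
    (hclose : ‖x - y‖ ≤ S.len n / 4) :
    (1 - 1 / 64) * (S.strength n * |inner ℝ (x - y) (nrm j)|) ≤ ‖S.displacement W n j x y‖ := by
  rw [norm_displacement, strength_mul_abs_inner]
  have hphase : |S.phase n j x - S.phase n j y| ≤ 1 / 4 := by
    rw [phase, phase, ← inner_sub_left, ← phase]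
    exact (S.abs_phase_le n j _).trans ((div_le_iff₀ (S.len_pos n)).2 (by linarith))
  have hnonneg : 0 ≤ S.amp n * (|S.phase n j x - S.phase n j y| * S.duration n) :=
    mul_nonneg (S.amp_nonneg n) (mul_nonneg (abs_nonneg _) (S.duration_pos n).le)
  calc (1 - 1 / 64) * (S.amp n * (|S.phase n j x - S.phase n j y| * S.duration n))
      ≤ S.amp n * ((1 - 1 / 256) * |S.phase n j x - S.phase n j y| *
          ((1 - 1 / 128) * S.duration n)) := by linarith
    _ ≤ _ := mul_le_mul_of_nonneg_left
        (mul_le_mul (le_norm_exp_mul_I_sub hphase) (S.le_norm_response hW n j hsmall)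
          (mul_nonneg (by norm_num) (S.duration_pos n).le) (norm_nonneg _)) (S.amp_nonneg n)

lemma stepMap_sub (n : ℕ) (k : Fin 4 × Fin 4) (x y : Space 2) :
    S.stepMap W n k x - S.stepMap W n k y =
      x - y + (Complex.I ^ (k.2 : ℕ) * S.displacement W n k.1 x y).im • dir k.1 := by
  have him : (Complex.I ^ (k.2 : ℕ) * S.displacement W n k.1 x y).im =
      S.amp n * (Complex.I ^ (k.2 : ℕ) *
        (Complex.exp (S.phase n k.1 x * Complex.I) * S.response W n k.1)).im -
      S.amp n * (Complex.I ^ (k.2 : ℕ) *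
        (Complex.exp (S.phase n k.1 y * Complex.I) * S.response W n k.1)).im := by
    rw [← mul_sub, ← Complex.sub_im, ← Complex.im_ofReal_mul, displacement]
    ring_nf
  rw [him, sub_smul, stepMap, stepMap]
  abel

lemma stepMap_injective (n : ℕ) (k : Fin 4 × Fin 4) : Function.Injective (S.stepMap W n k) := by
  intro x y hxy
  have hsub := S.stepMap_sub (W := W) n k x y
  rw [hxy, sub_self] at hsub
  have hinner : inner ℝ (x - y) (nrm k.1) = (0 : ℝ) := by
    have := congrArg (fun z => inner ℝ z (nrm k.1) : Space 2 → ℝ) hsub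
    simpa [inner_add_left, inner_smul_left, inner_dir_nrm] using this.symm
  have hzero : S.displacement W n k.1 x y = 0 := by
    simpa [hinner] using S.norm_displacement_le (W := W) n k.1 x y
  rw [hzero, mul_zero, Complex.zero_im, zero_smul, add_zero] at hsub
  exact sub_eq_zero.1 hsub.symm

lemma flow_injective (ω : ℕ → Fin 4 × Fin 4) (k n : ℕ) : Function.Injective (S.flow W ω k n) := by
  induction k generalizing n with
  | zero => exact fun _ _ h => h
  | succ k ih => exact fun x y h => ih (n + 1) (S.stepMap_injective n _ h)

lemma average_stepMap_le (hW : ContinuousOn W (Icc 0 1)) {n : ℕ}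
    (hκ : S.strength n ≤ 1 / 4000)
    (hsmall : ∀ r ∈ Icc (S.time (n + 1)) (S.time n),
      ‖W r - W (S.time (n + 1))‖ ≤ S.len n / 8) {x y : Space 2} (hxy : x ≠ y) :
    (∑ k, ‖S.stepMap W n k x - S.stepMap W n k y‖⁻¹) / 16 ≤
      (1 - S.strength n ^ 2 / 64) * ‖x - y‖⁻¹ + 8 * S.strength n ^ 2 / S.len n := by
  rw [Fintype.sum_prod_type]
  simp only [stepMap_sub]
  refine average_inv_norm_le (sub_ne_zero.2 hxy) (S.len_pos n) (S.strength_nonneg n) hκ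
    (fun j => ?_) fun hclose j => ?_
  · rw [← sq_abs (inner ℝ _ _), ← mul_pow]
    exact pow_le_pow_left₀ (norm_nonneg _) (S.norm_displacement_le n j x y) 2
  · have hnonneg := mul_nonneg (S.strength_nonneg n) (abs_nonneg (inner ℝ (x - y) (nrm j)))
    rw [← sq_abs (inner ℝ _ _), ← mul_pow]
    refine le_trans ?_ (pow_le_pow_left₀ (mul_nonneg (by norm_num) hnonneg)
      (S.le_norm_displacement hW hsmall j hclose) 2)
    rw [mul_pow (1 - 1 / 64)]
    exact mul_le_mul_of_nonneg_right (by norm_num) (sq_nonneg _)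

end Schedule

/-! ### Explosive separation -/

lemma map_update_infinitePi {ι : Type*} [DecidableEq ι] {E : ι → Type*}
    [∀ i, MeasurableSpace (E i)] (μ : ∀ i, Measure (E i)) [∀ i, IsProbabilityMeasure (μ i)]
    (n : ι) :
    ((Measure.infinitePi μ).prod (μ n)).map (fun p => Function.update p.1 n p.2) =
      Measure.infinitePi μ := by
  refine Measure.eq_infinitePi μ fun s t ht => ?_
  have hpreimage : (fun p : (∀ i, E i) × E n => Function.update p.1 n p.2) ⁻¹' (s : Set ι).pi t =
      ((s.erase n : Finset ι) : Set ι).pi t ×ˢ (if n ∈ s then t n else univ) := by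
    ext p
    rw [mem_preimage, mem_prod]
    simp only [Set.mem_pi, Finset.mem_coe, Finset.mem_erase]
    grind [Function.update_of_ne, Function.update_self]
  rw [Measure.map_apply (by fun_prop) (.pi s.countable_toSet fun i _ => ht i), hpreimage,
    Measure.prod_prod, Measure.infinitePi_pi μ fun i _ => ht i]
  split_ifs with hn
  · exact Finset.prod_erase_mul s (fun i => μ i (t i)) hn
  · rw [measure_univ, mul_one, Finset.erase_eq_of_notMem hn]

lemma lintegral_infinitePi_eq_lintegral_update {ι : Type*} [DecidableEq ι] {E : ι → Type*}
    [∀ i, MeasurableSpace (E i)] (μ : ∀ i, Measure (E i)) [∀ i, IsProbabilityMeasure (μ i)]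
    (n : ι) {F : (∀ i, E i) → ℝ≥0∞} (hF : Measurable F) :
    ∫⁻ ω, F ω ∂Measure.infinitePi μ =
      ∫⁻ ω, ∫⁻ k, F (Function.update ω n k) ∂μ n ∂Measure.infinitePi μ := by
  conv_lhs => rw [← map_update_infinitePi μ n]
  rw [lintegral_map hF (by fun_prop), lintegral_prod _ (by fun_prop)]

/-- The uniform distribution on the directions and phases of a shear. -/
def uniformKey : Measure (Fin 4 × Fin 4) := (PMF.uniformOfFintype (Fin 4 × Fin 4)).toMeasure

instance : IsProbabilityMeasure uniformKey :=
  inferInstanceAs (IsProbabilityMeasure (PMF.uniformOfFintype (Fin 4 × Fin 4)).toMeasure)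

/-- The law of independent, uniformly distributed directions and phases. -/
def noise : Measure (ℕ → Fin 4 × Fin 4) := Measure.infinitePi fun _ => uniformKey

instance : IsProbabilityMeasure noise :=
  inferInstanceAs (IsProbabilityMeasure (Measure.infinitePi fun _ : ℕ => uniformKey))

lemma lintegral_uniformKey (f : Fin 4 × Fin 4 → ℝ≥0∞) :
    ∫⁻ k, f k ∂uniformKey = (∑ k, f k) / 16 := by
  rw [lintegral_fintype, div_eq_mul_inv, Finset.sum_mul]
  refine Finset.sum_congr rfl fun k _ => ?_
  rw [uniformKey, PMF.toMeasure_apply_singleton _ _ .of_discrete, PMF.uniformOfFintype_apply]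
  norm_num

namespace Schedule

variable (S : Schedule) {W : ℝ → Space 2}

lemma continuous_stepMap (n : ℕ) (k : Fin 4 × Fin 4) : Continuous (S.stepMap W n k) := by
  unfold stepMap phase
  fun_prop

lemma measurable_flow (k n : ℕ) (x : Space 2) : Measurable fun ω => S.flow W ω k n x := by
  induction k generalizing n with
  | zero => exact measurable_const
  | succ k ih =>
    have hstep : Measurable fun p : (Fin 4 × Fin 4) × Space 2 => S.stepMap W n p.1 p.2 :=
      measurable_from_prod_countable_right fun k => (S.continuous_stepMap n k).measurable
    exact hstep.comp ((measurable_pi_apply n).prodMk (ih (n + 1)))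

lemma flow_update {m n : ℕ} (hmn : m < n) (ω : ℕ → Fin 4 × Fin 4) (key : Fin 4 × Fin 4) (k : ℕ)
    (x : Space 2) : S.flow W (Function.update ω m key) k n x = S.flow W ω k n x := by
  induction k generalizing n with
  | zero => rfl
  | succ k ih => rw [flow, flow, ih (hmn.trans n.lt_succ_self), Function.update_of_ne hmn.ne']

/-- The expected inverse distance of two particles after `k` shears, ending at time
`S.time n`: the Lyapunov function of the argument. -/
def meanInvDist (W : ℝ → Space 2) (k n : ℕ) (x y : Space 2) : ℝ≥0∞ :=
  ∫⁻ ω, ENNReal.ofReal ‖S.flow W ω k n x - S.flow W ω k n y‖⁻¹ ∂noise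

/-- The conditions under which the `n`-th shear separates particles. -/
structure Separates (W : ℝ → Space 2) (n : ℕ) : Prop where
  strength_le : S.strength n ≤ 1 / 4000
  path_le : ∀ r ∈ Icc (S.time (n + 1)) (S.time n), ‖W r - W (S.time (n + 1))‖ ≤ S.len n / 8
  len_le : S.len n ≤ S.len (n + 1) * (1 + S.strength n ^ 2 / 128)

variable {S}

lemma Separates.one_sub_nonneg {n : ℕ} (hn : S.Separates W n) : 0 ≤ 1 - S.strength n ^ 2 / 64 := by
  have := pow_le_pow_left₀ (S.strength_nonneg n) hn.strength_le 2
  linarith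

variable (S)

lemma measurable_inv_dist_flow (k n : ℕ) (x y : Space 2) :
    Measurable fun ω => ENNReal.ofReal ‖S.flow W ω k n x - S.flow W ω k n y‖⁻¹ :=
  ((S.measurable_flow k n x).sub (S.measurable_flow k n y)).norm.inv.ennreal_ofReal

lemma meanInvDist_succ_le (hW : ContinuousOn W (Icc 0 1)) {n : ℕ} (hn : S.Separates W n) (k : ℕ)
    {x y : Space 2} (hxy : x ≠ y) :
    S.meanInvDist W (k + 1) n x y ≤
      ENNReal.ofReal (1 - S.strength n ^ 2 / 64) * S.meanInvDist W k (n + 1) x y +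
        ENNReal.ofReal (8 * S.strength n ^ 2 / S.len n) := by
  have herror : 0 ≤ 8 * S.strength n ^ 2 / S.len n :=
    div_nonneg (mul_nonneg (by norm_num) (sq_nonneg _)) (S.len_pos n).le
  have hmeas := S.measurable_inv_dist_flow (W := W) k (n + 1) x y
  have hconst (c : ℝ≥0∞) : ∫⁻ _, c ∂noise = c := by rw [lintegral_const, measure_univ, mul_one]
  rw [meanInvDist, meanInvDist, ← lintegral_const_mul _ hmeas,
    ← hconst (ENNReal.ofReal (8 * _ / _)), ← lintegral_add_left (hmeas.const_mul _), noise,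
    lintegral_infinitePi_eq_lintegral_update _ n (S.measurable_inv_dist_flow (k + 1) n x y)]
  refine lintegral_mono fun ω => ?_
  simp only [lintegral_uniformKey, flow, Function.update_self, S.flow_update n.lt_succ_self]
  rw [← ENNReal.ofReal_mul hn.one_sub_nonneg, ← ENNReal.ofReal_add
      (mul_nonneg hn.one_sub_nonneg (inv_nonneg.2 (norm_nonneg _))) herror,
    ← ENNReal.ofReal_sum_of_nonneg fun _ _ => inv_nonneg.2 (norm_nonneg _),
    ← ENNReal.ofReal_ofNat 16, ← ENNReal.ofReal_div_of_pos (by norm_num)]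
  exact ENNReal.ofReal_le_ofReal (S.average_stepMap_le hW hn.strength_le hn.path_le
    ((S.flow_injective ω k (n + 1)).ne hxy))

lemma contraction_add_error_le {L L' c : ℝ} (hL : 0 < L) (hL' : 0 < L') (hc : c ≤ 64)
    (hlen : L ≤ L' * (1 + c / 128)) : (1 - c / 64) * (1024 / L') + 8 * c / L ≤ 1024 / L := by
  have hinv : 1024 / L' ≤ 1024 * (1 + c / 128) / L := by
    rw [div_le_div_iff₀ hL' hL]
    linarith
  calc (1 - c / 64) * (1024 / L') + 8 * c / L
      ≤ (1 - c / 64) * (1024 * (1 + c / 128) / L) + 8 * c / L := by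
        gcongr
        linarith
    _ = (1024 - c ^ 2 / 8) / L := by ring
    _ ≤ 1024 / L := by
        gcongr
        linarith [sq_nonneg c]

lemma meanInvDist_le (hW : ContinuousOn W (Icc 0 1)) {n₀ : ℕ}
    (hS : ∀ n, n₀ ≤ n → S.Separates W n) {x y : Space 2} (hxy : x ≠ y) (k n : ℕ) (hn : n₀ ≤ n)
    (hstart : ‖x - y‖⁻¹ ≤ 1024 / S.len (n + k)) :
    S.meanInvDist W k n x y ≤ ENNReal.ofReal (1024 / S.len n) := by
  induction k generalizing n with
  | zero =>
    simp only [meanInvDist, flow, lintegral_const, measure_univ, mul_one]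
    exact ENNReal.ofReal_le_ofReal hstart
  | succ k ih =>
    have hstep := hS n hn
    have hih := ih (n + 1) (hn.trans n.le_succ) (by rwa [Nat.add_right_comm, Nat.add_assoc])
    refine (S.meanInvDist_succ_le hW hstep k hxy).trans
      ((add_le_add_left (mul_le_mul_right hih _) _).trans ?_)
    rw [← ENNReal.ofReal_mul hstep.one_sub_nonneg, ← ENNReal.ofReal_add
      (mul_nonneg hstep.one_sub_nonneg (div_nonneg (by norm_num) (S.len_pos _).le))
      (div_nonneg (mul_nonneg (by norm_num) (sq_nonneg _)) (S.len_pos n).le)]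
    exact ENNReal.ofReal_le_ofReal (contraction_add_error_le (S.len_pos n) (S.len_pos (n + 1))
      (by linarith [hstep.one_sub_nonneg]) hstep.len_le)

lemma noise_norm_lt_le (hW : ContinuousOn W (Icc 0 1)) {n₀ : ℕ}
    (hS : ∀ n, n₀ ≤ n → S.Separates W n) {x y : Space 2} (hxy : x ≠ y) (k n : ℕ) (hn : n₀ ≤ n)
    (hstart : ‖x - y‖⁻¹ ≤ 1024 / S.len (n + k)) {δ : ℝ} (hδ : 0 < δ) :
    noise {ω | ‖solution (S.field ω) W (S.time (n + k)) x (S.time n) -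
      solution (S.field ω) W (S.time (n + k)) y (S.time n)‖ < δ} ≤
      ENNReal.ofReal (1024 / S.len n * δ) := by
  simp only [S.solution_eq_flow hW]
  have hsubset : {ω | ‖S.flow W ω k n x - S.flow W ω k n y‖ < δ} ⊆
      {ω | ENNReal.ofReal δ⁻¹ ≤ ENNReal.ofReal ‖S.flow W ω k n x - S.flow W ω k n y‖⁻¹} :=
    fun ω hω => ENNReal.ofReal_le_ofReal <| inv_anti₀
      (norm_pos_iff.2 (sub_ne_zero.2 ((S.flow_injective ω k n).ne hxy))) (le_of_lt hω)
  have hpos : ENNReal.ofReal δ⁻¹ ≠ 0 := (ENNReal.ofReal_pos.2 (inv_pos.2 hδ)).ne'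
  refine (measure_mono hsubset).trans ((meas_ge_le_lintegral_div
    (S.measurable_inv_dist_flow k n x y).aemeasurable hpos ENNReal.ofReal_ne_top).trans ?_)
  rw [ENNReal.div_le_iff hpos ENNReal.ofReal_ne_top,
    ← ENNReal.ofReal_mul (mul_nonneg (div_nonneg (by norm_num) (S.len_pos n).le) hδ.le),
    mul_assoc, mul_inv_cancel₀ hδ.ne', mul_one]
  exact S.meanInvDist_le hW hS hxy k n hn hstart

theorem explosivelySeparating_field (hW : ContinuousOn W (Icc 0 1))
    (hlen : Tendsto S.len atTop (𝓝 0)) (hS : ∀ᶠ n in atTop, S.Separates W n) :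
    ExplosivelySeparating noise S.field S.time W := by
  obtain ⟨n₀, hS⟩ := eventually_atTop.1 hS
  -- for large `n` the inner limit superior already vanishes
  refine tendsto_const_nhds.congr' ?_
  filter_upwards [eventually_ge_atTop n₀] with n hn
  refine (nonpos_iff_eq_zero.1 ?_).symm
  have hlim : Tendsto (fun δ : ℝ => ENNReal.ofReal (1024 / S.len n * δ)) (𝓝[>] 0) (𝓝 0) := by
    refine Tendsto.mono_left ?_ nhdsWithin_le_nhds
    simpa using ENNReal.tendsto_ofReal ((tendsto_id (x := 𝓝 (0 : ℝ))).const_mul (1024 / S.len n))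
  rw [← hlim.limsup_eq]
  refine limsup_le_limsup ?_
  filter_upwards [self_mem_nhdsWithin] with δ hδ
  refine limsup_le_of_le (by isBoundedDefault) ?_
  have hpos : ∀ᶠ p in closePairs 2, 0 < ‖p.1 - p.2‖ :=
    tendsto_comap.eventually (self_mem_nhdsWithin : Ioi (0 : ℝ) ∈ 𝓝[>] 0)
  filter_upwards [hpos] with p hp
  refine limsup_le_of_le (by isBoundedDefault) ?_
  filter_upwards [eventually_ge_atTop n, hlen.eventually_lt_const hp] with m hm hlm
  obtain ⟨k, rfl⟩ := Nat.exists_eq_add_of_le hm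
  refine S.noise_norm_lt_le hW hS (sub_ne_zero.1 (norm_pos_iff.1 hp)) k n hn ?_ hδ
  rw [inv_le_comm₀ hp (div_pos (by norm_num) (S.len_pos _)), inv_div]
  linarith [S.len_pos (n + k)]

end Schedule

/-! ### Shears of prescribed regularity -/

lemma bumpMass_le_one : bumpMass ≤ 1 := by
  have hmono := intervalIntegral.integral_mono_on zero_le_one
    (bump.continuous.intervalIntegrable 0 1)
    (continuous_const.intervalIntegrable (μ := volume) 0 1) fun x _ => bump.le_one (x := x)
  rwa [intervalIntegral.integral_const, sub_zero, one_smul] at hmono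

lemma isLittleO_succ_rpow {r s : ℝ} (hrs : r < s) :
    (fun n : ℕ => ((n : ℝ) + 1) ^ r) =o[atTop] fun n : ℕ => ((n : ℝ) + 1) ^ s := by
  have hpos (n : ℕ) : (0 : ℝ) < n + 1 := n.cast_add_one_pos
  refine Asymptotics.isLittleO_of_tendsto
    (fun n h => absurd h (Real.rpow_pos_of_pos (hpos n) s).ne') ?_
  have hlim := (tendsto_rpow_neg_atTop (sub_pos.2 hrs)).comp
    (tendsto_atTop_add_const_right atTop (1 : ℝ) tendsto_natCast_atTop_atTop)
  refine hlim.congr fun n => ?_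
  rw [Function.comp_apply, neg_sub, Real.rpow_sub (hpos n)]

lemma one_add_pow_six_le {u : ℝ} (h0 : 0 ≤ u) (h2 : u ≤ 2) : (1 + u) ^ 6 ≤ 1 + 364 * u := by
  have hfactor : 1 + 364 * u - (1 + u) ^ 6 =
      u * ((2 - u) * (u ^ 4 + 8 * u ^ 3 + 31 * u ^ 2 + 82 * u + 179)) := by
    ring
  have hnonneg : 0 ≤ u * ((2 - u) * (u ^ 4 + 8 * u ^ 3 + 31 * u ^ 2 + 82 * u + 179)) :=
    mul_nonneg h0 (mul_nonneg (sub_nonneg.2 h2) (by positivity))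
  linarith [hfactor, hnonneg]

lemma HolderPath.continuousOn {d : ℕ} {β : ℝ} {W : ℝ → Space d} (hβ : 0 < β)
    (hW : HolderPath β W) : ContinuousOn W (Icc 0 1) :=
  hW.elim fun _ hC => hC.continuousOn (Real.toNNReal_pos.2 hβ)

namespace SwitchingTimes

variable (T : SwitchingTimes)

lemma sum_step (n : ℕ) : ∑ k ∈ Finset.range n, T.step k = 1 - T.time n := by
  rw [← T.time_zero]
  exact Finset.sum_range_sub' T.time n

lemma succ_mul_step_le_one (hT : Antitone T.step) (n : ℕ) : ((n : ℝ) + 1) * T.step n ≤ 1 :=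
  calc ((n : ℝ) + 1) * T.step n = ∑ _k ∈ Finset.range (n + 1), T.step n := by simp
    _ ≤ ∑ k ∈ Finset.range (n + 1), T.step k :=
        Finset.sum_le_sum fun _ hk => hT (Nat.lt_succ_iff.1 (Finset.mem_range.1 hk))
    _ ≤ 1 := by
        rw [T.sum_step]
        exact sub_le_self _ (T.time_pos _).le

/-- The length scales for which the shears of amplitude `len n ^ α / 2` have strength proportional
to `(n + 1) ^ (-1 / 2)`. -/
def scale (α : ℝ) (n : ℕ) : ℝ := (bumpMass / 1000 * T.step n * √(n + 1)) ^ (1 / (1 - α))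

lemma scale_base_pos (n : ℕ) : 0 < bumpMass / 1000 * T.step n * √(n + 1) :=
  mul_pos (mul_pos (div_pos bumpMass_pos (by norm_num)) (T.step_pos n))
    (Real.sqrt_pos.2 n.cast_add_one_pos)

lemma scale_pos (α : ℝ) (n : ℕ) : 0 < T.scale α n := Real.rpow_pos_of_pos (T.scale_base_pos n) _

lemma scale_base_le (hT : Antitone T.step) (n : ℕ) :
    bumpMass / 1000 * T.step n * √(n + 1) ≤ (√((n : ℝ) + 1))⁻¹ := by
  have hsqrt : 0 < √((n : ℝ) + 1) := Real.sqrt_pos.2 n.cast_add_one_pos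
  have hmass : bumpMass / 1000 * T.step n ≤ T.step n :=
    mul_le_of_le_one_left (T.step_pos n).le (by linarith [bumpMass_le_one])
  rw [← one_div, le_div_iff₀ hsqrt, mul_assoc, Real.mul_self_sqrt n.cast_add_one_pos.le]
  calc bumpMass / 1000 * T.step n * ((n : ℝ) + 1) ≤ T.step n * ((n : ℝ) + 1) := by gcongr
    _ ≤ 1 := by
        rw [mul_comm]
        exact T.succ_mul_step_le_one hT n

variable {T} {α : ℝ}

lemma scale_le_one (hα : α < 1) (hT : Antitone T.step) (n : ℕ) : T.scale α n ≤ 1 :=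
  Real.rpow_le_one (T.scale_base_pos n).le
    ((T.scale_base_le hT n).trans (inv_le_one_of_one_le₀ (Real.one_le_sqrt.2 (by simp))))
    (one_div_pos.2 (sub_pos.2 hα)).le

lemma tendsto_scale (hα : α < 1) (hT : Antitone T.step) :
    Tendsto (T.scale α) atTop (𝓝 0) := by
  have hexp : 0 < 1 / (1 - α) := one_div_pos.2 (sub_pos.2 hα)
  have hsqrt : Tendsto (fun n : ℕ => (√((n : ℝ) + 1))⁻¹) atTop (𝓝 0) :=
    tendsto_inv_atTop_zero.comp <| Real.tendsto_sqrt_atTop.comp <|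
      tendsto_atTop_add_const_right _ _ tendsto_natCast_atTop_atTop
  have hbase : Tendsto (fun n : ℕ => bumpMass / 1000 * T.step n * √(n + 1)) atTop (𝓝 0) :=
    squeeze_zero (fun n => (T.scale_base_pos n).le) (T.scale_base_le hT) hsqrt
  rw [← Real.zero_rpow hexp.ne']
  exact hbase.rpow_const (Or.inr hexp.le)

lemma isBigO_scale (hα : α < 1) {p : ℝ}
    (hstep : T.step =O[atTop] fun n : ℕ => ((n : ℝ) + 1) ^ (-p)) :
    T.scale α =O[atTop] fun n : ℕ => ((n : ℝ) + 1) ^ (-(p - 1 / 2) / (1 - α)) := by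
  have hbase := (hstep.const_mul_left (bumpMass / 1000)).mul
    (Asymptotics.isBigO_refl (fun n : ℕ => √((n : ℝ) + 1)) atTop)
  refine (hbase.rpow (one_div_pos.2 (sub_pos.2 hα)).le
    (Eventually.of_forall fun n => by dsimp; positivity)).congr_right fun n => ?_
  have hn : (0 : ℝ) < n + 1 := n.cast_add_one_pos
  rw [Real.sqrt_eq_rpow, ← Real.rpow_add hn, ← Real.rpow_mul hn.le]
  congr 1
  ring

lemma rpow_neg_isBigO_scale (hα : α < 1) {q : ℝ}
    (hstep : (fun n : ℕ => ((n : ℝ) + 1) ^ (-q)) =O[atTop] T.step) :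
    (fun n : ℕ => ((n : ℝ) + 1) ^ (-(q - 1 / 2) / (1 - α))) =O[atTop] T.scale α := by
  have hbase := (hstep.trans (Asymptotics.isBigO_self_const_mul
    (div_ne_zero bumpMass_pos.ne' (by norm_num : (1000 : ℝ) ≠ 0)) T.step atTop)).mul
    (Asymptotics.isBigO_refl (fun n : ℕ => √((n : ℝ) + 1)) atTop)
  refine (hbase.rpow (one_div_pos.2 (sub_pos.2 hα)).le
    (Eventually.of_forall fun n => (T.scale_base_pos n).le)).congr_left fun n => ?_
  have hn : (0 : ℝ) < n + 1 := n.cast_add_one_pos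
  rw [Real.sqrt_eq_rpow, ← Real.rpow_add hn, ← Real.rpow_mul hn.le]
  congr 1
  ring

lemma eventually_norm_sub_le_scale (hα : α < 1) {p q β : ℝ} (hβ : 0 < β)
    (hup : T.step =O[atTop] fun n : ℕ => ((n : ℝ) + 1) ^ (-p))
    (hlow : (fun n : ℕ => ((n : ℝ) + 1) ^ (-q)) =O[atTop] T.step)
    (hpq : (q - 1 / 2) / (1 - α) < p * β) {d : ℕ} {W : ℝ → Space d} (hW : HolderPath β W) :
    ∀ᶠ n in atTop, ∀ r ∈ Icc (T.time (n + 1)) (T.time n),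
      ‖W r - W (T.time (n + 1))‖ ≤ T.scale α n / 8 := by
  obtain ⟨C, hC⟩ := hW
  have hpow : (fun n => T.step n ^ β) =O[atTop] fun n : ℕ => ((n : ℝ) + 1) ^ (-(p * β)) :=
    (hup.rpow hβ.le (Eventually.of_forall fun n => by dsimp; positivity)).congr_right fun n => by
      rw [← Real.rpow_mul n.cast_add_one_pos.le, neg_mul]
  have hsmall : (fun n => C * T.step n ^ β) =o[atTop] T.scale α :=
    (hpow.const_mul_left C).trans_isLittleO <|
      (isLittleO_succ_rpow (by rw [neg_div]; linarith)).trans_isBigO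
        (rpow_neg_isBigO_scale hα hlow)
  filter_upwards [hsmall.def (by norm_num : (0 : ℝ) < 1 / 8)] with n hn r hr
  have hmem : Icc (T.time (n + 1)) (T.time n) ⊆ Icc 0 1 :=
    Icc_subset_Icc (T.time_pos _).le (T.time_le_one n)
  have hholder := hC.dist_le (hmem hr) (hmem (left_mem_Icc.2 (hr.1.trans hr.2)))
  rw [dist_eq_norm, Real.coe_toNNReal _ hβ.le, Real.dist_eq,
    abs_of_nonneg (sub_nonneg.2 hr.1)] at hholder
  calc ‖W r - W (T.time (n + 1))‖ ≤ C * (r - T.time (n + 1)) ^ β := hholder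
    _ ≤ C * T.step n ^ β := by
        gcongr
        · exact sub_nonneg.2 hr.1
        · exact sub_le_sub_right hr.2 _
    _ ≤ 1 / 8 * ‖T.scale α n‖ := (Real.le_norm_self _).trans hn
    _ = T.scale α n / 8 := by
        rw [Real.norm_of_nonneg (T.scale_pos α n).le, one_div_mul_eq_div]

lemma scale_le_scale_succ_mul (hα : α < 1) {e : ℝ} (he : e ≤ 6 * (1 - α))
    (hratio : ∀ n : ℕ, T.step n ≤ T.step (n + 1) * (1 + 2 / ((n : ℝ) + 1)) ^ e) (n : ℕ) :
    T.scale α n ≤ T.scale α (n + 1) * (1 + 728 / ((n : ℝ) + 1)) := by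
  have h1α := sub_pos.2 hα
  have hmass := bumpMass_pos
  have hstep := T.step_pos (n + 1)
  set u : ℝ := 2 / ((n : ℝ) + 1) with hu
  have hu0 : 0 < u := by positivity
  have hu2 : u ≤ 2 := div_le_self zero_le_two (by simp)
  have hbase : bumpMass / 1000 * T.step n * √(n + 1) ≤
      bumpMass / 1000 * T.step (n + 1) * √((n + 1 : ℕ) + 1) * (1 + u) ^ e :=
    calc bumpMass / 1000 * T.step n * √(n + 1)
        ≤ bumpMass / 1000 * (T.step (n + 1) * (1 + u) ^ e) * √((n + 1 : ℕ) + 1) := by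
          gcongr
          · exact hratio n
          · exact n.le_succ
      _ = bumpMass / 1000 * T.step (n + 1) * √((n + 1 : ℕ) + 1) * (1 + u) ^ e := by ring
  have hexp : ((1 + u) ^ e) ^ (1 / (1 - α)) ≤ 1 + 364 * u :=
    calc ((1 + u) ^ e) ^ (1 / (1 - α)) = (1 + u) ^ (e / (1 - α)) := by
          rw [← Real.rpow_mul (by positivity), mul_one_div]
      _ ≤ (1 + u) ^ (6 : ℝ) :=
          Real.rpow_le_rpow_of_exponent_le (by linarith) ((div_le_iff₀ h1α).2 he)
      _ ≤ 1 + 364 * u := by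
          exact_mod_cast one_add_pow_six_le hu0.le hu2
  calc T.scale α n
      ≤ (bumpMass / 1000 * T.step (n + 1) * √((n + 1 : ℕ) + 1) * (1 + u) ^ e) ^ (1 / (1 - α)) :=
        Real.rpow_le_rpow (T.scale_base_pos n).le hbase (one_div_pos.2 h1α).le
    _ = T.scale α (n + 1) * ((1 + u) ^ e) ^ (1 / (1 - α)) :=
        Real.mul_rpow (T.scale_base_pos (n + 1)).le (by positivity)
    _ ≤ T.scale α (n + 1) * (1 + 364 * u) :=
        mul_le_mul_of_nonneg_left hexp (T.scale_pos α (n + 1)).le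
    _ = T.scale α (n + 1) * (1 + 728 / ((n : ℝ) + 1)) := by rw [hu]; ring

/-- The schedule with switching times `T` and length scales `T.scale α`, whose shears have
amplitude `len n ^ α / 2` and hence `C^α` norm at most `2`. -/
def schedule (T : SwitchingTimes) (α : ℝ) : Schedule where
  toSwitchingTimes := T
  amp n := T.scale α n ^ α / 2
  len := T.scale α
  amp_nonneg n := div_nonneg (Real.rpow_nonneg (T.scale_pos α n).le _) zero_le_two
  len_pos := T.scale_pos α

lemma strength_schedule (hα : α < 1) (n : ℕ) :
    (T.schedule α).strength n = 500 / √((n : ℝ) + 1) := by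
  have hmass := bumpMass_pos
  have hstep := T.step_pos n
  have : 0 < √((n : ℝ) + 1) := Real.sqrt_pos.2 n.cast_add_one_pos
  have h1α : 1 - α ≠ 0 := (sub_pos.2 hα).ne'
  have hratio : T.scale α n ^ α / T.scale α n = (bumpMass / 1000 * T.step n * √(n + 1))⁻¹ := by
    rw [← Real.rpow_sub_one (T.scale_pos α n).ne', scale, ← Real.rpow_mul (T.scale_base_pos n).le,
      ← Real.rpow_neg_one]
    congr 1
    field_simp
    ring
  calc (T.schedule α).strength n
      = T.scale α n ^ α / T.scale α n * (T.step n * bumpMass) / 2 := by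
        rw [Schedule.strength, Schedule.duration, schedule]
        ring
    _ = 500 / √((n : ℝ) + 1) := by
        rw [hratio]
        field_simp
        norm_num

lemma cNorm_field_schedule_le (hα : α < 1) (hT : Antitone T.step) (ω : ℕ → Fin 4 × Fin 4)
    (t : ℝ) : cNorm α ((T.schedule α).field ω t) ≤ 2 :=
  (T.schedule α).cNorm_field_le ω hα.le (scale_le_one hα hT) (fun _ => le_rfl) t

lemma memL1C0_field_schedule (hα : α < 1) {p : ℝ}
    (hup : T.step =O[atTop] fun n : ℕ => ((n : ℝ) + 1) ^ (-p))
    (hp : 1 / 2 < (p - 1 / 2) / (1 - α)) (ω : ℕ → Fin 4 × Fin 4) :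
    MemL1C0 ((T.schedule α).field ω) := by
  refine (T.schedule α).memL1C0_field ω (summable_of_isBigO_nat
    (g := fun n : ℕ => ((n : ℝ) + 1) ^ (-(1 / 2) + -(p - 1 / 2) / (1 - α))) ?_ ?_)
  · have hsum := (summable_nat_add_iff 1).2 (Real.summable_nat_rpow
      (p := -(1 / 2) + -(p - 1 / 2) / (1 - α)) |>.2 (by rw [neg_div]; linarith))
    simpa only [Nat.cast_add, Nat.cast_one] using hsum
  · have hprod := ((Asymptotics.isBigO_refl (fun n : ℕ => ((n : ℝ) + 1) ^ (-(1 / 2) : ℝ))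
      atTop).mul (isBigO_scale hα hup)).const_mul_left (500 / bumpMass)
    refine hprod.congr (fun n => ?_) fun n => (Real.rpow_add n.cast_add_one_pos _ _).symm
    have hamp : (T.schedule α).amp n * T.step n =
        (T.schedule α).strength n * T.scale α n / bumpMass := by
      have hmass := bumpMass_pos.ne'
      have hlen := (T.scale_pos α n).ne'
      rw [Schedule.strength, Schedule.duration, schedule]
      field_simp
    rw [show (T.schedule α).step n = T.step n from rfl, hamp, strength_schedule hα,
      Real.rpow_neg n.cast_add_one_pos.le, ← Real.sqrt_eq_rpow]
    ring

theorem explosivelySeparating_field_schedule (hα : α < 1) {e p q β : ℝ} (hβ : 0 < β)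
    (hT : Antitone T.step)
    (hratio : ∀ n : ℕ, T.step n ≤ T.step (n + 1) * (1 + 2 / ((n : ℝ) + 1)) ^ e)
    (he : e ≤ 6 * (1 - α))
    (hup : T.step =O[atTop] fun n : ℕ => ((n : ℝ) + 1) ^ (-p))
    (hlow : (fun n : ℕ => ((n : ℝ) + 1) ^ (-q)) =O[atTop] T.step)
    (hpq : (q - 1 / 2) / (1 - α) < p * β) {W : ℝ → Space 2} (hW : HolderPath β W) :
    ExplosivelySeparating noise (T.schedule α).field T.time W := by
  have hstrength : Tendsto (fun n : ℕ => 500 / √((n : ℝ) + 1)) atTop (𝓝 0) :=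
    tendsto_const_nhds.div_atTop <| Real.tendsto_sqrt_atTop.comp <|
      tendsto_atTop_add_const_right _ _ tendsto_natCast_atTop_atTop
  refine (T.schedule α).explosivelySeparating_field (hW.continuousOn hβ) (tendsto_scale hα hT) ?_
  filter_upwards [eventually_norm_sub_le_scale hα hβ hup hlow hpq hW,
    hstrength.eventually_le_const (by norm_num : (0 : ℝ) < 1 / 4000)] with n hpath hsmall
  refine ⟨(strength_schedule hα n).trans_le hsmall, hpath,
    (scale_le_scale_succ_mul hα he hratio n).trans
      (mul_le_mul_of_nonneg_left ?_ (T.scale_pos α (n + 1)).le)⟩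
  rw [strength_schedule hα, div_pow, Real.sq_sqrt n.cast_add_one_pos.le, div_right_comm]
  gcongr
  norm_num

end SwitchingTimes

/-! ### Switching times sampled from a profile -/

lemma sub_add_one_mem_Icc_of_hasDerivAt_neg {f h : ℝ → ℝ} {x : ℝ}
    (hf : ∀ y ∈ Icc x (x + 1), HasDerivAt f (-h y) y) (hh : AntitoneOn h (Icc x (x + 1))) :
    f x - f (x + 1) ∈ Icc (h (x + 1)) (h x) := by
  have hx : x < x + 1 := lt_add_one x
  obtain ⟨ξ, hξ, hslope⟩ := exists_hasDerivAt_eq_slope f (fun y => -h y) hx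
    (fun y hy => (hf y hy).continuousAt.continuousWithinAt)
    (fun y hy => hf y (Ioo_subset_Icc_self hy))
  have hsub : f x - f (x + 1) = h ξ := by
    rw [add_sub_cancel_left, div_one] at hslope
    linarith
  have hξ' := Ioo_subset_Icc_self hξ
  rw [hsub]
  exact ⟨hh hξ' (right_mem_Icc.2 hx.le) hξ'.2, hh (left_mem_Icc.2 hx.le) hξ' hξ'.1⟩

/-- A function decreasing from `1` at `1` to `0` at infinity with antitone speed. Its values at the
positive integers serve as switching times. -/
structure TimeProfile where
  position : ℝ → ℝ
  speed : ℝ → ℝ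
  position_one : position 1 = 1
  position_tendsto : Tendsto position atTop (𝓝 0)
  hasDerivAt_position : ∀ x ∈ Ici (1 : ℝ), HasDerivAt position (-speed x) x
  speed_pos : ∀ x ∈ Ici (1 : ℝ), 0 < speed x
  speed_anti : AntitoneOn speed (Ici 1)

namespace TimeProfile

variable (φ : TimeProfile)

lemma position_sub_mem_Icc (n : ℕ) :
    φ.position (n + 1) - φ.position (n + 1 + 1) ∈ Icc (φ.speed (n + 1 + 1)) (φ.speed (n + 1)) := by
  have hsubset : Icc ((n : ℝ) + 1) (n + 1 + 1) ⊆ Ici 1 := fun x hx => le_trans (by simp) hx.1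
  exact sub_add_one_mem_Icc_of_hasDerivAt_neg
    (fun x hx => φ.hasDerivAt_position x (hsubset hx)) (φ.speed_anti.mono hsubset)

/-- The values of a profile at the positive integers. -/
def times : SwitchingTimes where
  time n := φ.position (n + 1)
  time_zero := by rw [Nat.cast_zero, zero_add, φ.position_one]
  time_anti := strictAnti_nat_of_succ_lt fun n => by
    have hpos := φ.speed_pos (n + 1 + 1) (mem_Ici.2 (by linarith [n.cast_nonneg (α := ℝ)]))
    rw [Nat.cast_succ]
    linarith [(φ.position_sub_mem_Icc n).1]
  time_tendsto := φ.position_tendsto.comp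
    (tendsto_atTop_add_const_right _ _ tendsto_natCast_atTop_atTop)

lemma step_times_mem_Icc (n : ℕ) :
    φ.times.step n ∈ Icc (φ.speed (n + 1 + 1)) (φ.speed (n + 1)) := by
  have hstep : φ.times.step n = φ.position (n + 1) - φ.position ((n + 1 : ℕ) + 1) := rfl
  rw [hstep, Nat.cast_succ]
  exact φ.position_sub_mem_Icc n

lemma antitone_step_times : Antitone φ.times.step :=
  antitone_nat_of_succ_le fun n => by
    have hle := (φ.step_times_mem_Icc (n + 1)).2
    rw [Nat.cast_succ] at hle
    exact hle.trans (φ.step_times_mem_Icc n).1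

variable {φ}

lemma step_times_le_mul {e : ℝ}
    (hspeed : ∀ x ∈ Ici (1 : ℝ), ∀ c ∈ Ici (1 : ℝ), φ.speed x ≤ φ.speed (c * x) * c ^ e) (n : ℕ) :
    φ.times.step n ≤ φ.times.step (n + 1) * (1 + 2 / ((n : ℝ) + 1)) ^ e := by
  have hn : (0 : ℝ) < n + 1 := n.cast_add_one_pos
  have hmul : (1 + 2 / ((n : ℝ) + 1)) * (n + 1) = (n + 1 : ℕ) + 1 + 1 := by
    rw [add_mul, div_mul_cancel₀ _ hn.ne', Nat.cast_succ]
    ring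
  calc φ.times.step n ≤ φ.speed (n + 1) := (φ.step_times_mem_Icc n).2
    _ ≤ φ.speed ((n + 1 : ℕ) + 1 + 1) * (1 + 2 / ((n : ℝ) + 1)) ^ e := by
        rw [← hmul]
        exact hspeed _ (mem_Ici.2 (by simp)) _
          (mem_Ici.2 (le_add_of_nonneg_right (by positivity)))
    _ ≤ φ.times.step (n + 1) * (1 + 2 / ((n : ℝ) + 1)) ^ e := by
        gcongr
        exact (φ.step_times_mem_Icc (n + 1)).1

lemma isBigO_step_times {p : ℝ} (hspeed : φ.speed =O[atTop] fun x : ℝ => x ^ (-p)) :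
    φ.times.step =O[atTop] fun n : ℕ => ((n : ℝ) + 1) ^ (-p) := by
  refine (Asymptotics.isBigO_of_le _ fun n => ?_).trans (hspeed.comp_tendsto
    (tendsto_atTop_add_const_right _ (1 : ℝ) tendsto_natCast_atTop_atTop))
  rw [Real.norm_of_nonneg (φ.times.step_pos n).le]
  exact (φ.step_times_mem_Icc n).2.trans (Real.le_norm_self _)

lemma rpow_neg_isBigO_step_times {q : ℝ} (hq : 0 ≤ q)
    (hspeed : (fun x : ℝ => x ^ (-q)) =O[atTop] φ.speed) :
    (fun n : ℕ => ((n : ℝ) + 1) ^ (-q)) =O[atTop] φ.times.step := by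
  have hshift : (fun n : ℕ => ((n : ℝ) + 1) ^ (-q)) =O[atTop]
      fun n : ℕ => ((n : ℝ) + 1 + 1) ^ (-q) := by
    refine .of_bound (2 ^ q) (Eventually.of_forall fun n => ?_)
    have hn : (0 : ℝ) < n + 1 := n.cast_add_one_pos
    rw [Real.norm_of_nonneg (by positivity), Real.norm_of_nonneg (by positivity),
      Real.rpow_neg hn.le, Real.rpow_neg (by positivity), inv_le_iff_one_le_mul₀ (by positivity),
      mul_right_comm, ← Real.mul_rpow zero_le_two hn.le, ← div_eq_mul_inv,
      one_le_div (by positivity)]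
    exact Real.rpow_le_rpow (by positivity) (by linarith) hq
  have hsample := hspeed.comp_tendsto <| tendsto_atTop_add_const_right atTop (1 : ℝ) <|
    tendsto_atTop_add_const_right atTop (1 : ℝ) (tendsto_natCast_atTop_atTop (R := ℝ))
  refine (hshift.trans hsample).trans (Asymptotics.isBigO_of_le _ fun n => ?_)
  rw [Function.comp_apply, Real.norm_of_nonneg
    (φ.speed_pos _ (mem_Ici.2 (by linarith [n.cast_nonneg (α := ℝ)]))).le]
  exact (φ.step_times_mem_Icc n).1.trans (Real.le_norm_self _)

end TimeProfile

lemma one_le_one_add_log {x : ℝ} (hx : 1 ≤ x) : 1 ≤ 1 + Real.log x :=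
  le_add_of_nonneg_right (Real.log_nonneg hx)

/-- The profile of logarithmically decaying switching times. -/
def logProfile : TimeProfile where
  position x := (1 + Real.log x)⁻¹
  speed x := (x * (1 + Real.log x) ^ 2)⁻¹
  position_one := by rw [Real.log_one, add_zero, inv_one]
  position_tendsto :=
    tendsto_inv_atTop_zero.comp (tendsto_atTop_add_const_left _ _ Real.tendsto_log_atTop)
  hasDerivAt_position x hx := by
    have hlog := one_le_one_add_log hx
    refine (((Real.hasDerivAt_log (zero_lt_one.trans_le hx).ne').const_add 1).inv
      (by positivity)).congr_deriv ?_
    rw [mul_inv, neg_div, div_eq_mul_inv]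
  speed_pos x hx := by
    have hlog := one_le_one_add_log hx
    have hx0 : 0 < x := zero_lt_one.trans_le hx
    positivity
  speed_anti x hx y _ hxy := by
    have hlog := one_le_one_add_log hx
    have hx0 : 0 < x := zero_lt_one.trans_le hx
    have hy0 : 0 < y := hx0.trans_le hxy
    dsimp only
    gcongr

lemma speed_logProfile (x : ℝ) : logProfile.speed x = (x * (1 + Real.log x) ^ 2)⁻¹ := rfl

lemma speed_logProfile_le_mul {x c : ℝ} (hx : 1 ≤ x) (hc : 1 ≤ c) :
    logProfile.speed x ≤ logProfile.speed (c * x) * c ^ (3 : ℝ) := by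
  have hx0 : 0 < x := zero_lt_one.trans_le hx
  have hc0 : 0 < c := zero_lt_one.trans_le hc
  have hlog := Real.log_nonneg hx
  have hlogc := Real.log_nonneg hc
  have hlogmul : 1 + Real.log (c * x) ≤ c * (1 + Real.log x) := by
    rw [Real.log_mul hc0.ne' hx0.ne']
    linarith [Real.log_le_sub_one_of_pos hc0, le_mul_of_one_le_left hlog hc]
  have hpos : 0 < 1 + Real.log (c * x) := by
    rw [Real.log_mul hc0.ne' hx0.ne']
    positivity
  rw [speed_logProfile, speed_logProfile, inv_mul_eq_div, inv_eq_one_div,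
    div_le_div_iff₀ (by positivity) (by positivity)]
  calc 1 * (c * x * (1 + Real.log (c * x)) ^ 2)
      ≤ 1 * (c * x * (c * (1 + Real.log x)) ^ 2) := by gcongr
    _ = c ^ (3 : ℝ) * (x * (1 + Real.log x) ^ 2) := by
        norm_cast
        ring

lemma isBigO_speed_logProfile :
    logProfile.speed =O[atTop] fun x : ℝ => x ^ (-1 : ℝ) := by
  refine .of_bound 1 ?_
  filter_upwards [eventually_ge_atTop 1] with x hx
  have hx0 : 0 < x := zero_lt_one.trans_le hx
  rw [Real.norm_of_nonneg (logProfile.speed_pos x hx).le, Real.norm_of_nonneg (by positivity),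
    one_mul, Real.rpow_neg_one]
  exact inv_anti₀ hx0 (le_mul_of_one_le_right hx0.le (one_le_pow₀ (one_le_one_add_log hx)))

lemma rpow_neg_isBigO_speed_logProfile {q : ℝ} (hq : 1 < q) :
    (fun x : ℝ => x ^ (-q)) =O[atTop] logProfile.speed := by
  have hexp : 0 < (q - 1) / 2 := half_pos (sub_pos.2 hq)
  have hconst : (fun _ : ℝ => (1 : ℝ)) =O[atTop] fun x : ℝ => x ^ ((q - 1) / 2) :=
    (Asymptotics.isLittleO_const_left.2 (Or.inr (tendsto_norm_atTop_atTop.comp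
      (tendsto_rpow_atTop hexp)))).isBigO
  have hlog : (fun x => 1 + Real.log x) =O[atTop] fun x : ℝ => x ^ ((q - 1) / 2) :=
    hconst.add (isLittleO_log_rpow_atTop hexp).isBigO
  have hinv := ((Asymptotics.isBigO_refl (fun x : ℝ => x) atTop).mul (hlog.pow 2)).inv_rev (by
    filter_upwards [eventually_ge_atTop 1] with x hx hzero
    exact absurd hzero (inv_pos.1 (logProfile.speed_pos x hx)).ne')
  refine hinv.congr' ?_ (EventuallyEq.refl _ _)
  filter_upwards [eventually_gt_atTop 0] with x hx
  rw [← Real.rpow_mul_natCast hx.le, Real.rpow_neg hx.le, ← Real.rpow_one_add' hx.le]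
  · congr 2
    push_cast
    ring
  · push_cast
    linarith

/-- The profile of the switching times `(n + 1) ^ (-γ)`. -/
def powProfile (γ : ℝ) (hγ : 0 < γ) : TimeProfile where
  position x := x ^ (-γ)
  speed x := γ * x ^ (-(1 + γ))
  position_one := Real.one_rpow _
  position_tendsto := tendsto_rpow_neg_atTop hγ
  hasDerivAt_position x hx := by
    refine (Real.hasDerivAt_rpow_const (Or.inl (zero_lt_one.trans_le hx).ne')).congr_deriv ?_
    rw [neg_mul, neg_add']
    ring_nf
  speed_pos x hx := mul_pos hγ (Real.rpow_pos_of_pos (zero_lt_one.trans_le hx) _)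
  speed_anti x hx y hy hxy := mul_le_mul_of_nonneg_left
    (Real.rpow_le_rpow_of_nonpos (zero_lt_one.trans_le hx) hxy (by linarith)) hγ.le

lemma speed_powProfile {γ : ℝ} (hγ : 0 < γ) (x : ℝ) :
    (powProfile γ hγ).speed x = γ * x ^ (-(1 + γ)) := rfl

lemma speed_powProfile_mul {γ : ℝ} (hγ : 0 < γ) {x c : ℝ} (hx : 0 ≤ x) (hc : 0 < c) :
    (powProfile γ hγ).speed (c * x) * c ^ (1 + γ) = (powProfile γ hγ).speed x := by
  rw [speed_powProfile, speed_powProfile, mul_comm c, Real.mul_rpow hx hc.le, mul_assoc,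
    mul_assoc, ← Real.rpow_add hc,
    neg_add_cancel, Real.rpow_zero, mul_one]

lemma isTheta_speed_powProfile {γ : ℝ} (hγ : 0 < γ) :
    (powProfile γ hγ).speed =Θ[atTop] fun x : ℝ => x ^ (-(1 + γ)) :=
  (Asymptotics.isTheta_refl _ _).const_mul_left hγ.ne'

lemma exists_decay_exponent {ρ β : ℝ} (hρ : 0 ≤ ρ) (hβ : 1 / (2 + ρ) < β) :
    ∃ γ, ρ / 2 < γ ∧ γ ≤ ρ / 2 + 1 ∧ (γ + 1 / 2) / (1 + ρ) < (1 + γ) * β := by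
  have hη : 0 < (1 + ρ / 2) * β - 1 / 2 := by
    rw [div_lt_iff₀ (by linarith)] at hβ
    linarith
  have hβ0 : 0 < β := hβ.trans' (by positivity)
  refine ⟨ρ / 2 + min 1 ((1 + ρ / 2) * β - 1 / 2),
    lt_add_of_pos_right _ (lt_min one_pos hη), by gcongr; exact min_le_left _ _, ?_⟩
  rw [div_lt_iff₀ (by linarith)]
  set ε := min 1 ((1 + ρ / 2) * β - 1 / 2)
  have hε : 0 < ε := lt_min one_pos hη
  have hεη : ε ≤ (1 + ρ / 2) * β - 1 / 2 := min_le_right _ _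
  nlinarith [mul_nonneg hρ hη.le, mul_pos hε hβ0, mul_nonneg hρ (mul_pos hε hβ0).le]

theorem explosivelySeparating_logProfile {α β : ℝ} (hα : α < 1 / 2) (hβ : 1 / (2 * (1 - α)) < β)
    {W : ℝ → Space 2} (hW : HolderPath β W) :
    ExplosivelySeparating noise (logProfile.times.schedule α).field logProfile.times.time W := by
  have h1α : 0 < 1 - α := by linarith
  have hgap : 1 < 1 / 2 + (1 - α) * β := by
    rw [div_lt_iff₀ (by positivity)] at hβ
    linarith
  obtain ⟨q, hq, hqβ⟩ := exists_between hgap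
  refine logProfile.times.explosivelySeparating_field_schedule (by linarith)
    (hβ.trans' (by positivity)) logProfile.antitone_step_times
    (TimeProfile.step_times_le_mul fun x hx c hc => speed_logProfile_le_mul hx hc) (by linarith)
    (TimeProfile.isBigO_step_times isBigO_speed_logProfile)
    (TimeProfile.rpow_neg_isBigO_step_times (by linarith) (rpow_neg_isBigO_speed_logProfile hq))
    ?_ hW
  rw [one_mul, div_lt_iff₀ h1α]
  linarith

theorem memL1C0_field_powProfile {γ ρ : ℝ} (hγ : 0 < γ) (hρ : 0 ≤ ρ) (hργ : ρ / 2 < γ)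
    (ω : ℕ → Fin 4 × Fin 4) : MemL1C0 (((powProfile γ hγ).times.schedule (-ρ)).field ω) := by
  refine SwitchingTimes.memL1C0_field_schedule (by linarith)
    (TimeProfile.isBigO_step_times (isTheta_speed_powProfile hγ).1) ?_ ω
  rw [sub_neg_eq_add, lt_div_iff₀ (by linarith)]
  linarith

theorem explosivelySeparating_powProfile {γ ρ β : ℝ} (hγ : 0 < γ) (hρ : 0 ≤ ρ) (hβ : 0 < β)
    (hγρ : γ ≤ ρ / 2 + 1) (hγβ : (γ + 1 / 2) / (1 + ρ) < (1 + γ) * β)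
    {W : ℝ → Space 2} (hW : HolderPath β W) :
    ExplosivelySeparating noise ((powProfile γ hγ).times.schedule (-ρ)).field
      (powProfile γ hγ).times.time W := by
  refine (powProfile γ hγ).times.explosivelySeparating_field_schedule (by linarith) hβ
    (powProfile γ hγ).antitone_step_times
    (TimeProfile.step_times_le_mul fun x hx c hc => (speed_powProfile_mul hγ
      (zero_le_one.trans hx) (zero_lt_one.trans_le hc)).ge) (by linarith)
    (TimeProfile.isBigO_step_times (isTheta_speed_powProfile hγ).1)
    (TimeProfile.rpow_neg_isBigO_step_times (by linarith) (isTheta_speed_powProfile hγ).2) ?_ hW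
  convert hγβ using 2 <;> ring

end ExplosiveSeparation

end

open ExplosiveSeparation in
theorem theorem1p6_general :
    (∀ α : ℝ, α < 1 / 2 →
      ∃ (Ω : Type) (_ : MeasurableSpace Ω) (P : Measure Ω) (_ : IsProbabilityMeasure P)
        (v : Ω → ℝ → Space 2 → Space 2),
        (∀ t ∈ Icc (0 : ℝ) 1, ∀ x, Measurable (fun ω => v ω t x)) ∧
        (∀ ω, ∀ t ∈ Icc (0 : ℝ) 1, cNorm α (v ω t) ≤ 2) ∧
        (∀ ω, SmoothPositiveTimes (v ω)) ∧
        (∀ ω, UniquelySolvable (v ω)) ∧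
        ∃ T : ℕ → ℝ, (∀ n, T n ∈ Ioc (0 : ℝ) 1) ∧ Tendsto T atTop (𝓝 0) ∧
          ∀ β : ℝ, 1 / (2 * (1 - α)) < β →
            ∀ W : ℝ → Space 2, HolderPath β W → ExplosivelySeparating P v T W) ∧
    (∀ ρ : ℝ, 0 ≤ ρ → ∀ β : ℝ, 1 / (2 + ρ) < β →
      ∃ (Ω : Type) (_ : MeasurableSpace Ω) (P : Measure Ω) (_ : IsProbabilityMeasure P)
        (u : Ω → ℝ → Space 2 → Space 2),
        (∀ t ∈ Icc (0 : ℝ) 1, ∀ x, Measurable (fun ω => u ω t x)) ∧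
        (∀ ω, ∀ t ∈ Icc (0 : ℝ) 1, cNorm (-ρ) (u ω t) ≤ 2) ∧
        (∀ ω, MemL1C0 (u ω)) ∧
        (∀ ω, SmoothPositiveTimes (u ω)) ∧
        (∀ ω, UniquelySolvable (u ω)) ∧
        ∃ T : ℕ → ℝ, (∀ n, T n ∈ Ioc (0 : ℝ) 1) ∧ Tendsto T atTop (𝓝 0) ∧
          ∀ W : ℝ → Space 2, HolderPath β W → ExplosivelySeparating P u T W) := by
  refine ⟨fun α hα => ?_, fun ρ hρ β hβ => ?_⟩
  · let S := logProfile.times.schedule α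
    exact ⟨_, _, noise, inferInstance, S.field, fun t _ x => S.measurable_field t x,
      fun ω t _ => SwitchingTimes.cNorm_field_schedule_le (by linarith)
        logProfile.antitone_step_times ω t,
      S.smoothPositiveTimes_field, S.uniquelySolvable_field, S.time, S.time_mem_Ioc,
      S.time_tendsto, fun _ hβ _ hW => explosivelySeparating_logProfile hα hβ hW⟩
  · obtain ⟨γ, hργ, hγρ, hγβ⟩ := exists_decay_exponent hρ hβ
    have hγ : 0 < γ := hργ.trans_le' (by positivity)
    let S := (powProfile γ hγ).times.schedule (-ρ)
    exact ⟨_, _, noise, inferInstance, S.field, fun t _ x => S.measurable_field t x,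
      fun ω t _ => SwitchingTimes.cNorm_field_schedule_le (by linarith)
        (powProfile γ hγ).antitone_step_times ω t,
      memL1C0_field_powProfile hγ hρ hργ, S.smoothPositiveTimes_field, S.uniquelySolvable_field,
      S.time, S.time_mem_Ioc, S.time_tendsto, fun _ hW =>
        explosivelySeparating_powProfile hγ hρ (hβ.trans' (by positivity)) hγρ hγβ hW⟩

theorem theorem1p6 :
    (∀ α : ℝ, α < 1 / 2 →
      ∃ (Ω : Type) (_ : MeasurableSpace Ω) (P : Measure Ω) (_ : IsProbabilityMeasure P)
        (v : Ω → ℝ → ExplosiveSeparation.Space 2 → ExplosiveSeparation.Space 2),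
        (∀ t ∈ Icc (0 : ℝ) 1, ∀ x, Measurable (fun ω => v ω t x)) ∧
        (∀ ω, ∀ t ∈ Icc (0 : ℝ) 1, ExplosiveSeparation.cNorm α (v ω t) ≤ 2) ∧
        (∀ ω, ExplosiveSeparation.SmoothPositiveTimes (v ω)) ∧
        (∀ ω, ExplosiveSeparation.UniquelySolvable (v ω)) ∧
        ∃ T : ℕ → ℝ, (∀ n, T n ∈ Ioc (0 : ℝ) 1) ∧ Tendsto T atTop (𝓝 0) ∧
          ∀ β : ℝ, 1 / (2 * (1 - α)) < β → β ≤ 1 →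
            ∀ W : ℝ → ExplosiveSeparation.Space 2, ExplosiveSeparation.HolderPath β W →
              ExplosiveSeparation.ExplosivelySeparating P v T W) ∧
    (∀ ρ : ℝ, 0 < ρ → ρ < 1 / 2 →
      ∃ (Ω : Type) (_ : MeasurableSpace Ω) (P : Measure Ω) (_ : IsProbabilityMeasure P)
        (u : Ω → ℝ → ExplosiveSeparation.Space 2 → ExplosiveSeparation.Space 2),
        (∀ t ∈ Icc (0 : ℝ) 1, ∀ x, Measurable (fun ω => u ω t x)) ∧
        (∀ ω, ∀ t ∈ Icc (0 : ℝ) 1, ExplosiveSeparation.cNorm (-ρ) (u ω t) ≤ 2) ∧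
        (∀ ω, ExplosiveSeparation.MemL1C0 (u ω)) ∧
        (∀ ω, ExplosiveSeparation.SmoothPositiveTimes (u ω)) ∧
        (∀ ω, ExplosiveSeparation.UniquelySolvable (u ω)) ∧
        ∃ T : ℕ → ℝ, (∀ n, T n ∈ Ioc (0 : ℝ) 1) ∧ Tendsto T atTop (𝓝 0) ∧
          ∀ W : ℝ → ExplosiveSeparation.Space 2,
            ExplosiveSeparation.HolderPath ((1 + ρ / 8) / (2 + ρ / 2)) W →
              ExplosiveSeparation.ExplosivelySeparating P u T W) := by
  refine ⟨fun α hα => ?_, fun ρ hρ _ => theorem1p6_general.2 ρ hρ.le _ ?_⟩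
  · obtain ⟨Ω, _, P, hP, v, hmeas, hnorm, hsmooth, hsolv, T, hT, hT0, hsep⟩ :=
      theorem1p6_general.1 α hα
    exact ⟨Ω, _, P, hP, v, hmeas, hnorm, hsmooth, hsolv, T, hT, hT0, fun β hβ _ => hsep β hβ⟩
  · rw [div_lt_div_iff₀ (by positivity) (by positivity)]
    nlinarith [sq_nonneg ρ]
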